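/- Let $c\ge 0$, let $\mathbb H_c=L^2(\mathbb R,e^{-2ct}\,dt)$ be the Hilbert space of complex-valued functions that are square integrable for the measure $e^{-2ct}\,dt$, and let $\partial_c$ be the operator $\partial_c f=f'$ on $\mathbb H_c$ with domain $$D(\partial_c)=\{f\in\mathbb H_c:\ f \text{ locally absolutely continuous on }\mathbb R,\ f'\in\mathbb H_c\}.$$ Then $\partial_c=\int_{\mathbb C} z\,dE(z)$ for a projection-valued measure $E$ on the Borel sets of $\mathbb C$. Let $\mathfrak a_c=\zeta(\partial_c)=\int\zeta\,dE$, with domain $\{f\in\mathbb H_c:\int|\zeta|^2\,d\langle Ef,f\rangle<\infty\}$, be the spectral operator, defined by the measurable functional calculus for unbounded normal operators, where $\zeta$ is the Riemann zeta function. Then $$\sigma(\mathfrak a_c)=\overline{\zeta(\sigma(\partial_c)\setminus\{1\})}=\overline{\zeta(\{s\in\mathbb C:\ \operatorname{Re}s=c,\ s\neq 1\})},$$ where $\sigma(A)$ denotes the spectrum of a (possibly unbounded) operator $A$, i.e. the set of $\lambda\in\mathbb C$ for which $A-\lambda$ has no bounded everywhere defined two-sided inverse, and the bar denotes closure in $\mathbb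 C$. (The pole $s=1$ of $\zeta$ lies on the line only when $c=1$.) -/

import Mathlib

open MeasureTheory Filter Topology
open scoped ENNReal

noncomputable section

namespace SpectralOp

section Operators

variable {H : Type*} [NormedAddCommGroup H] [InnerProductSpace ℂ H] [CompleteSpace H]

/-- `z` is in the resolvent set of the (possibly unbounded) operator `A`: there is a bounded
everywhere defined operator `R` with values in the domain of `A` such that `(A - z) R u = u` for
all `u`, and `R (A - z) v = v` for all `v` in the domain of `A`. -/
def InResolventSet (A : H →ₗ.[ℂ] H) (z : ℂ) : Prop :=
  ∃ R : H →L[ℂ] H,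
    (∀ u : H, ∃ v : A.domain, (v : H) = R u ∧ A v - z • (v : H) = u) ∧
    (∀ v : A.domain, R (A v - z • (v : H)) = v)

/-- The spectrum of a (possibly unbounded) operator. -/
def opSpectrum (A : H →ₗ.[ℂ] H) : Set ℂ :=
  {z | ¬ InResolventSet A z}

variable (H) in
/-- A resolution of the identity (projection-valued measure) on the Borel sets of `ℂ`. The value on
non-Borel sets is the dummy value `0`. -/
structure ResolutionOfIdentity where
  proj : Set ℂ → H →L[ℂ] H
  not_measurable : ∀ B, ¬ MeasurableSet B → proj B = 0
  isStarProjection : ∀ B, MeasurableSet B → IsStarProjection (proj B)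
  univ : proj Set.univ = 1
  inter : ∀ B C, MeasurableSet B → MeasurableSet C → proj (B ∩ C) = proj B * proj C
  iUnion : ∀ B : ℕ → Set ℂ, (∀ n, MeasurableSet (B n)) → Pairwise (fun i j => Disjoint (B i) (B j)) →
    ∀ x : H, HasSum (fun n => proj (B n) x) (proj (⋃ n, B n) x)

namespace ResolutionOfIdentity

variable (E : ResolutionOfIdentity H)

theorem proj_empty : E.proj ∅ = 0 := by
  ext x
  have h := E.iUnion (fun _ => ∅) (fun _ => MeasurableSet.empty) (fun _ _ _ => by simp) x
  have h0 := h.summable.tendsto_atTop_zero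
  simpa using tendsto_nhds_unique tendsto_const_nhds h0

theorem inner_proj_self {B : Set ℂ} (hB : MeasurableSet B) (x : H) :
    inner ℂ x (E.proj B x) = ((‖E.proj B x‖ ^ 2 : ℝ) : ℂ) := by
  have hp := E.isStarProjection B hB
  have h1 : E.proj B (E.proj B x) = E.proj B x :=
    congrArg (fun T : H →L[ℂ] H => T x) hp.isIdempotentElem
  have h2 := hp.isSelfAdjoint.isSymmetric x (E.proj B x)
  simp only [ContinuousLinearMap.coe_coe] at h2
  rw [h1] at h2
  rw [← h2, inner_self_eq_norm_sq_to_K]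
  simp

theorem hasSum_norm_sq (x : H) (B : ℕ → Set ℂ) (hB : ∀ n, MeasurableSet (B n))
    (hd : Pairwise (fun i j => Disjoint (B i) (B j))) :
    HasSum (fun n => ‖E.proj (B n) x‖ ^ 2) (‖E.proj (⋃ n, B n) x‖ ^ 2) := by
  have h := (E.iUnion B hB hd x).mapL (innerSL ℂ x)
  simp only [innerSL_apply_apply, E.inner_proj_self (hB _),
    E.inner_proj_self (MeasurableSet.iUnion hB)] at h
  exact Complex.hasSum_ofReal.mp h

/-- The positive measure `B ↦ ⟨E(B) x, x⟩ = ‖E(B) x‖²`. -/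
def measure (x : H) : Measure ℂ :=
  Measure.ofMeasurable (fun B _ => ENNReal.ofReal (‖E.proj B x‖ ^ 2))
    (by simp [proj_empty])
    (fun B hB hd => by
      have h := E.hasSum_norm_sq x B hB hd
      rw [← h.tsum_eq, ENNReal.ofReal_tsum_of_nonneg (fun n => by positivity) h.summable])

theorem measure_apply (x : H) {B : Set ℂ} (hB : MeasurableSet B) :
    E.measure x B = ENNReal.ofReal (‖E.proj B x‖ ^ 2) :=
  Measure.ofMeasurable_apply B hB

theorem measure_add_le (x y : H) :
    E.measure (x + y) ≤ (2 : ℝ≥0∞) • (E.measure x + E.measure y) := by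
  refine Measure.le_iff.2 fun B hB => ?_
  simp only [Measure.smul_apply, Measure.add_apply, smul_eq_mul, E.measure_apply _ hB]
  rw [← ENNReal.ofReal_add (by positivity) (by positivity),
    ← ENNReal.ofReal_ofNat 2, ← ENNReal.ofReal_mul (by norm_num)]
  apply ENNReal.ofReal_le_ofReal
  have h1 : ‖E.proj B (x + y)‖ ≤ ‖E.proj B x‖ + ‖E.proj B y‖ := by
    rw [map_add]; exact norm_add_le _ _
  have h2 := norm_nonneg (E.proj B (x + y))
  nlinarith [sq_nonneg (‖E.proj B x‖ - ‖E.proj B y‖)]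

theorem measure_smul (a : ℂ) (x : H) :
    E.measure (a • x) = ENNReal.ofReal (‖a‖ ^ 2) • E.measure x := by
  refine Measure.ext fun B hB => ?_
  simp only [Measure.smul_apply, smul_eq_mul, E.measure_apply _ hB]
  rw [← ENNReal.ofReal_mul (by positivity), map_smul, norm_smul, mul_pow]

/-- `∫ s dE` for a simple function `s`. -/
def simpleIntegral (s : SimpleFunc ℂ ℂ) : H →L[ℂ] H :=
  ∑ z ∈ s.range, z • E.proj (s ⁻¹' {z})

/-- The graph of `f(E) = ∫ f dE` for a Borel function `f`. Its domain consists of the vectors `x`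
with `∫ |f|² d⟨E x, x⟩ < ∞`, and `∫ f dE x` is the limit of `∫ sₙ dE x` for simple functions
`sₙ → f` dominated by a constant multiple of `|f|` (the limit exists and does not depend on the
sequence, by dominated convergence in `L²(⟨E x, x⟩)`). -/
def integralGraph (f : ℂ → ℂ) : Submodule ℂ (H × H) where
  carrier := {p | ∫⁻ z, ‖f z‖ₑ ^ 2 ∂(E.measure p.1) < ∞ ∧
    ∀ (s : ℕ → SimpleFunc ℂ ℂ) (C : ℝ), (∀ n z, ‖s n z‖ ≤ C * ‖f z‖) →
      (∀ z, Tendsto (fun n => s n z) atTop (𝓝 (f z))) →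
      Tendsto (fun n => E.simpleIntegral (s n) p.1) atTop (𝓝 p.2)}
  add_mem' := by
    rintro ⟨x, x'⟩ ⟨y, y'⟩ ⟨hx, hx'⟩ ⟨hy, hy'⟩
    refine ⟨?_, fun s C hC hs => ?_⟩
    · refine (lintegral_mono' (E.measure_add_le x y) le_rfl).trans_lt ?_
      rw [lintegral_smul_measure, lintegral_add_measure]
      exact ENNReal.mul_lt_top (by simp) (ENNReal.add_lt_top.2 ⟨hx, hy⟩)
    · simpa using (hx' s C hC hs).add (hy' s C hC hs)
  zero_mem' := by
    refine ⟨?_, fun s C _ _ => by simp⟩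
    have h : E.measure (0 : H) = 0 := by
      refine Measure.ext fun B hB => ?_
      simp [E.measure_apply _ hB]
    simp [h]
  smul_mem' := by
    rintro a ⟨x, x'⟩ ⟨hx, hx'⟩
    refine ⟨?_, fun s C hC hs => ?_⟩
    · simp only [Prod.smul_mk, E.measure_smul]
      rw [lintegral_smul_measure]
      exact ENNReal.mul_lt_top ENNReal.ofReal_lt_top hx
    · simpa using (hx' s C hC hs).const_smul a

/-- The operator `∫ f dE`, for a Borel function `f`. -/
def integral (f : ℂ → ℂ) : H →ₗ.[ℂ] H :=
  (E.integralGraph f).toLinearPMap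

end ResolutionOfIdentity

/-- `E` is the resolution of the identity (spectral measure) of the operator `A`, i.e.
`A = ∫ z dE(z)`. -/
def IsResolutionOf (E : ResolutionOfIdentity H) (A : H →ₗ.[ℂ] H) : Prop :=
  E.integral id = A

open Classical in
/-- The measurable functional calculus `f(A) = ∫ f dE`, where `E` is the resolution of the identity
of the normal operator `A` (with the dummy value `⊥` if there is none). -/
def functionalCalculus (A : H →ₗ.[ℂ] H) (f : ℂ → ℂ) : H →ₗ.[ℂ] H :=
  if h : ∃ E : ResolutionOfIdentity H, IsResolutionOf E A then h.choose.integral f else ⊥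

end Operators

section Shift

/-- The measure `e^{-2ct} dt` on the real line. -/
def weightMeasure (c : ℝ) : Measure ℝ :=
  volume.withDensity (fun t => ENNReal.ofReal (Real.exp (-2 * c * t)))

/-- The Hilbert space `L²(ℝ, e^{-2ct} dt)` of complex-valued functions. -/
abbrev WeightedL2 (c : ℝ) : Type := Lp ℂ 2 (weightMeasure c)

/-- Local absolute continuity on the real line. -/
def LocallyAC (g : ℝ → ℂ) : Prop :=
  ∀ a b : ℝ, AbsolutelyContinuousOnInterval g a b

theorem weightMeasure_ac (c : ℝ) : weightMeasure c ≪ volume :=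
  withDensity_absolutelyContinuous _ _

theorem LocallyAC.ae_differentiableAt {g : ℝ → ℂ} (hg : LocallyAC g) (c : ℝ) :
    ∀ᵐ t ∂(weightMeasure c), DifferentiableAt ℝ g t := by
  apply (weightMeasure_ac c).ae_le
  have h : ∀ n : ℕ, ∀ᵐ t : ℝ, t ∈ Set.uIcc (-(n : ℝ)) n → DifferentiableAt ℝ g t := fun n =>
    (hg _ _).boundedVariationOn.ae_differentiableAt_of_mem_uIcc
  filter_upwards [ae_all_iff.2 h] with t ht
  obtain ⟨n, hn⟩ := exists_nat_ge |t|
  refine ht n ?_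
  have := abs_le.1 hn
  rw [Set.uIcc_of_le (by linarith)]
  exact this

/-- The graph of the differentiation operator: pairs `(f, f')` in `L²(ℝ, e^{-2ct} dt)` such that
`f` is (represented by) a locally absolutely continuous function. -/
def shiftGraph (c : ℝ) : Submodule ℂ (WeightedL2 c × WeightedL2 c) where
  carrier := {p | ∃ g : ℝ → ℂ, LocallyAC g ∧ p.1 =ᵐ[weightMeasure c] g ∧
    p.2 =ᵐ[weightMeasure c] deriv g}
  add_mem' := by
    rintro ⟨x, x'⟩ ⟨y, y'⟩ ⟨g, hg, hx, hx'⟩ ⟨k, hk, hy, hy'⟩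
    refine ⟨g + k, fun a b => (hg a b).add (hk a b), ?_, ?_⟩
    · exact (Lp.coeFn_add x y).trans (hx.add hy)
    · refine (Lp.coeFn_add x' y').trans ?_
      filter_upwards [hx', hy', hg.ae_differentiableAt c, hk.ae_differentiableAt c]
        with t h1 h2 h3 h4
      rw [Pi.add_apply, deriv_add h3 h4]
      exact congrArg₂ _ h1 h2
  zero_mem' := by
    refine ⟨fun _ => 0, fun a b => ?_, Lp.coeFn_zero _ _ _, ?_⟩
    · simp [AbsolutelyContinuousOnInterval, tendsto_const_nhds]
    · filter_upwards [Lp.coeFn_zero ℂ 2 (weightMeasure c)] with t ht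
      simpa using ht
  smul_mem' := by
    rintro a ⟨x, x'⟩ ⟨g, hg, hx, hx'⟩
    refine ⟨fun t => a • g t, fun p q => (hg p q).const_smul a, ?_, ?_⟩
    · refine (Lp.coeFn_smul a x).trans ?_
      filter_upwards [hx] with t h1
      exact congrArg (a • ·) h1
    · refine (Lp.coeFn_smul a x').trans ?_
      filter_upwards [hx', hg.ae_differentiableAt c] with t h1 h2
      rw [Pi.smul_apply, deriv_fun_const_smul a h2]
      exact congrArg (a • ·) h1

/-- The infinitesimal shift `∂_c f = f'`, with domain the (classes of) locally absolutely continuous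
`f ∈ L²(ℝ, e^{-2ct} dt)` with `f' ∈ L²(ℝ, e^{-2ct} dt)`. -/
def infinitesimalShift (c : ℝ) : WeightedL2 c →ₗ.[ℂ] WeightedL2 c :=
  (shiftGraph c).toLinearPMap

/-- The spectral operator `ζ(∂_c)`. For `c = 1` the point `1` carries no mass of the resolution of
the identity of `∂_c`, so the value chosen for `ζ` at its pole does not matter here. -/
def spectralOperator (c : ℝ) : WeightedL2 c →ₗ.[ℂ] WeightedL2 c :=
  functionalCalculus (infinitesimalShift c) riemannZeta

end Shift

end SpectralOp

end

/-! Conjugating by $f \mapsto \mathcal F(e^{-ct}f)$ turns $\partial_c$ into multiplication by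
$c+2\pi i\xi$ on $L^2(\mathbb R)$, so indicators of preimages under $\xi\mapsto c+2\pi i\xi$ give a
resolution of the identity for $\partial_c$ (`isResolutionOf_shiftResolution`). One inclusion of
graphs is an $L^2$ inversion statement (`exists_locallyAC_fourierInv`). The other is a resolvent
argument: the multiplication operator minus $c+1$ is onto, while differentiation minus $c+1$ is
injective, so the two operators coincide.

For any resolution $E$ and any Borel $f$, the spectrum of $\int f\,dE$ is the $E$-essential range of
$f$ (`opSpectrum_integral`). This rests on the isometry $\|\int f\,dE\,x\|^2=\int |f|^2\,d\langle
Ex,x\rangle$ and on the composition rule `mem_integralGraph_of_mul`.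

The functional calculus uses some chosen resolution of $\partial_c$, not necessarily the explicit
one. Uniqueness is bypassed: three facts are derived for every resolution $E$ of $\partial_c$. Balls
centred on the line $\operatorname{Re}z=c$ have nonzero projection and the complement of the line is
null, because both follow from the spectrum of $\partial_c$. Points are null, because $\partial_c$
has no eigenvectors. As $\zeta$ is continuous away from $1$ and $\{1\}$ is null, the essential range
of $\zeta$ is the closure of its values on the line without $1$. -/

noncomputable section

namespace SpectralOp

/-! ### Spectral integrals of simple functions. -/

section Abstract

theorem norm_sum_sq_of_pairwise_orthogonal {H ι : Type*} [NormedAddCommGroup H] [InnerProductSpace ℂ H]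
    (t : Finset ι) (v : ι → H)
    (h : ∀ i j, i ≠ j → inner ℂ (v i) (v j) = 0) :
    ‖∑ i ∈ t, v i‖ ^ 2 = ∑ i ∈ t, ‖v i‖ ^ 2 := by
  classical
  induction t using Finset.induction_on with
  | empty => simp
  | insert a t ha ih =>
    rw [Finset.sum_insert ha, Finset.sum_insert ha, ← ih]
    have : inner ℂ (v a) (∑ i ∈ t, v i) = 0 := by
      rw [inner_sum]
      exact Finset.sum_eq_zero fun i hi => h _ _ (by rintro rfl; exact ha hi)
    have h3 := norm_add_sq_eq_norm_sq_add_norm_sq_of_inner_eq_zero (𝕜 := ℂ) _ _ this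
    nlinarith


variable {H : Type*} [NormedAddCommGroup H] [InnerProductSpace ℂ H] [CompleteSpace H]

namespace ResolutionOfIdentity

variable (E : ResolutionOfIdentity H)

theorem proj_union {B C : Set ℂ} (hB : MeasurableSet B) (hC : MeasurableSet C)
    (h : Disjoint B C) : E.proj (B ∪ C) = E.proj B + E.proj C := by
  ext x
  let F : ℕ → Set ℂ := fun n => if n = 0 then B else if n = 1 then C else ∅
  have hF : ∀ n, MeasurableSet (F n) := by
    intro n; simp only [F]; split_ifs <;> simp [hB, hC]
  have hd : Pairwise (fun i j => Disjoint (F i) (F j)) := by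
    intro i j hij
    simp only [F]
    split_ifs <;> simp_all [disjoint_comm]
  have hU : (⋃ n, F n) = B ∪ C := by
    ext z
    simp only [Set.mem_iUnion, Set.mem_union, F]
    constructor
    · rintro ⟨n, hn⟩
      split_ifs at hn <;> simp_all
    · rintro (hz | hz)
      · exact ⟨0, by simpa using hz⟩
      · exact ⟨1, by simpa using hz⟩
  have h1 := E.iUnion F hF hd x
  rw [hU] at h1
  have h2 : HasSum (fun n => E.proj (F n) x) (∑ n ∈ Finset.range 2, E.proj (F n) x) := by
    refine hasSum_sum_of_ne_finset_zero fun n hn => ?_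
    have : n ≠ 0 ∧ n ≠ 1 := by simp at hn; omega
    simp [F, this, E.proj_empty]
  rw [h1.unique h2]
  simp [Finset.sum_range_succ, F]

theorem proj_proj {B C : Set ℂ} (hB : MeasurableSet B) (hC : MeasurableSet C) (x : H) :
    E.proj B (E.proj C x) = E.proj (B ∩ C) x := by
  rw [E.inter B C hB hC]; rfl

theorem measure_univ (x : H) : E.measure x Set.univ = ‖x‖ₑ ^ 2 := by
  rw [E.measure_apply x MeasurableSet.univ, E.univ]
  simp [ENNReal.ofReal_pow, ofReal_norm]

theorem measure_apply' (x : H) {B : Set ℂ} (hB : MeasurableSet B) :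
    E.measure x B = ‖E.proj B x‖ₑ ^ 2 := by
  rw [E.measure_apply x hB]
  simp [ENNReal.ofReal_pow, ofReal_norm]

/-- The set function `B ↦ (z ↦ z • E(B))`. -/
def weighted (B : Set ℂ) : ℂ →L[ℝ] (H →L[ℂ] H) :=
  ((ContinuousLinearMap.toSpanSingleton ℂ (E.proj B)).restrictScalars ℝ)

/-- Makes the `setToSimpleFunc` calculus available, which yields linearity of `simpleIntegral`. With
the zero measure all finiteness and integrability side conditions are trivial. -/
theorem finMeasAdditive_weighted : FinMeasAdditive (0 : Measure ℂ) E.weighted := by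
  intro B C hB hC _ _ h
  ext z : 1
  simp [weighted, E.proj_union hB hC h, smul_add]

theorem simpleIntegral_eq (s : SimpleFunc ℂ ℂ) :
    E.simpleIntegral s = SimpleFunc.setToSimpleFunc E.weighted s := by
  simp [simpleIntegral, SimpleFunc.setToSimpleFunc, weighted]

theorem simpleIntegral_add (s t : SimpleFunc ℂ ℂ) :
    E.simpleIntegral (s + t) = E.simpleIntegral s + E.simpleIntegral t := by
  simp only [simpleIntegral_eq]
  exact SimpleFunc.setToSimpleFunc_add _ E.finMeasAdditive_weighted (integrable_zero_measure)
    (integrable_zero_measure)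

theorem simpleIntegral_sub (s t : SimpleFunc ℂ ℂ) :
    E.simpleIntegral (s - t) = E.simpleIntegral s - E.simpleIntegral t := by
  simp only [simpleIntegral_eq]
  exact SimpleFunc.setToSimpleFunc_sub _ E.finMeasAdditive_weighted (integrable_zero_measure)
    (integrable_zero_measure)

theorem simpleIntegral_indicator (a : ℂ) {B : Set ℂ} (hB : MeasurableSet B) :
    E.simpleIntegral (SimpleFunc.piecewise B hB (SimpleFunc.const ℂ a) (SimpleFunc.const ℂ 0)) =
      a • E.proj B := by
  rw [simpleIntegral_eq, SimpleFunc.setToSimpleFunc_indicator _ _ hB]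
  · simp [weighted]
  · simp [weighted, E.proj_empty]

/-- By bilinearity it is enough to treat indicators, where it is $E(B\cap C)=E(B)E(C)$. -/
theorem simpleIntegral_mul (s t : SimpleFunc ℂ ℂ) :
    E.simpleIntegral (s * t) = E.simpleIntegral s * E.simpleIntegral t := by
  induction s using SimpleFunc.induction with
  | const a hB =>
    rename_i B
    induction t using SimpleFunc.induction with
    | const b hC =>
      rename_i C
      have h : SimpleFunc.piecewise B hB (SimpleFunc.const ℂ a) (SimpleFunc.const ℂ 0) *
          SimpleFunc.piecewise C hC (SimpleFunc.const ℂ b) (SimpleFunc.const ℂ 0) =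
          SimpleFunc.piecewise (B ∩ C) (hB.inter hC) (SimpleFunc.const ℂ (a * b))
            (SimpleFunc.const ℂ 0) := by
        ext z
        by_cases h1 : z ∈ B <;> by_cases h2 : z ∈ C <;> simp [h1, h2]
      rw [h, simpleIntegral_indicator, simpleIntegral_indicator, simpleIntegral_indicator,
        E.inter B C hB hC, smul_mul_smul_comm]
    | add _ hf hg => rw [mul_add, simpleIntegral_add, hf, hg, simpleIntegral_add, mul_add]
  | add _ hf hg => rw [add_mul, simpleIntegral_add, hf, hg, simpleIntegral_add, add_mul]

theorem inner_proj_of_disjoint {B C : Set ℂ} (hB : MeasurableSet B) (hC : MeasurableSet C)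
    (h : Disjoint B C) (x y : H) : inner ℂ (E.proj B x) (E.proj C y) = 0 := by
  have h2 := (E.isStarProjection B hB).isSelfAdjoint.isSymmetric x (E.proj C y)
  simp only [ContinuousLinearMap.coe_coe] at h2
  rw [h2, E.proj_proj hB hC, h.inter_eq, E.proj_empty]
  simp

/-- Pythagoras: distinct fibres of $s$ are disjoint, so the vectors $E(s^{-1}\{z\})x$ are mutually
orthogonal. This isometry controls every limit taken below. -/
theorem enorm_simpleIntegral_sq (s : SimpleFunc ℂ ℂ) (x : H) :
    ‖E.simpleIntegral s x‖ₑ ^ 2 = ∫⁻ z, ‖s z‖ₑ ^ 2 ∂(E.measure x) := by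
  have h1 : ∫⁻ z, ‖s z‖ₑ ^ 2 ∂(E.measure x) =
      ∑ z ∈ s.range, ‖z‖ₑ ^ 2 * E.measure x (s ⁻¹' {z}) := by
    rw [← SimpleFunc.map_lintegral (fun z : ℂ => ‖z‖ₑ ^ 2) s,
      ← SimpleFunc.lintegral_eq_lintegral]
    rfl
  have h2 : ‖E.simpleIntegral s x‖ ^ 2 = ∑ z ∈ s.range, ‖z • E.proj (s ⁻¹' {z}) x‖ ^ 2 := by
    rw [simpleIntegral, _root_.sum_apply]
    refine norm_sum_sq_of_pairwise_orthogonal _ (fun z => z • E.proj (s ⁻¹' {z}) x) ?_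
    intro z w hzw
    rw [inner_smul_left, inner_smul_right, E.inner_proj_of_disjoint (s.measurableSet_fiber z)
      (s.measurableSet_fiber w)]
    · simp
    · exact Disjoint.preimage _ (by simpa using hzw)
  rw [h1, ← ofReal_norm, ← ENNReal.ofReal_pow (norm_nonneg _), h2,
    ENNReal.ofReal_sum_of_nonneg (fun _ _ => by positivity)]
  refine Finset.sum_congr rfl fun z _ => ?_
  rw [E.measure_apply x (s.measurableSet_fiber z), norm_smul, mul_pow,
    ENNReal.ofReal_mul (by positivity), ENNReal.ofReal_pow (norm_nonneg _), ofReal_norm]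

end ResolutionOfIdentity
end Abstract

/-! ### Square-mean convergence and approximation by simple functions. -/

theorem enorm_sub_sq_le (a b c : ℂ) : ‖a - b‖ₑ ^ 2 ≤ 2 * (‖a - c‖ₑ ^ 2 + ‖b - c‖ₑ ^ 2) := by
  simp only [← ofReal_norm]
  rw [← ENNReal.ofReal_pow (norm_nonneg _), ← ENNReal.ofReal_pow (norm_nonneg _),
    ← ENNReal.ofReal_pow (norm_nonneg _), ← ENNReal.ofReal_add (by positivity) (by positivity),
    ← ENNReal.ofReal_ofNat 2, ← ENNReal.ofReal_mul (by norm_num)]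
  apply ENNReal.ofReal_le_ofReal
  have h1 : ‖a - b‖ ≤ ‖a - c‖ + ‖b - c‖ := by
    rw [← sub_sub_sub_cancel_right a b c]; exact norm_sub_le _ _
  have h2 := norm_nonneg (a - b)
  nlinarith [sq_nonneg (‖a - c‖ - ‖b - c‖)]

theorem tendsto_zero_of_sq_tendsto_zero {ι : Type*} {l : Filter ι} {e : ι → ℝ≥0∞}
    (h : Tendsto (fun n => e n ^ 2) l (𝓝 0)) : Tendsto e l (𝓝 0) := by
  have h1 := (ENNReal.continuous_rpow_const (y := (1 / 2 : ℝ))).continuousAt.tendsto.comp h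
  have h2 : ∀ n, (e n ^ 2) ^ (1 / 2 : ℝ) = e n := by
    intro n
    rw [← ENNReal.rpow_natCast, ← ENNReal.rpow_mul]
    norm_num
  simp only [Function.comp_def, h2] at h1
  simpa using h1

theorem tendsto_lintegral_enorm_sub_sq {α : Type*} [MeasurableSpace α] {μ : Measure α}
    {f : α → ℂ} {s : ℕ → α → ℂ} {C : ℝ} (hf : AEMeasurable f μ) (hs : ∀ n, AEMeasurable (s n) μ)
    (hfin : ∫⁻ z, ‖f z‖ₑ ^ 2 ∂μ < ∞) (hC : ∀ n, ∀ᵐ z ∂μ, ‖s n z‖ ≤ C * ‖f z‖)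
    (hlim : ∀ᵐ z ∂μ, Tendsto (fun n => s n z) atTop (𝓝 (f z))) :
    Tendsto (fun n => ∫⁻ z, ‖s n z - f z‖ₑ ^ 2 ∂μ) atTop (𝓝 0) := by
  have h := tendsto_lintegral_of_dominated_convergence' (μ := μ)
    (F := fun n z => ‖s n z - f z‖ₑ ^ 2) (f := fun _ => 0)
    (fun z => ENNReal.ofReal ((C + 1) ^ 2) * ‖f z‖ₑ ^ 2)
    (fun n => ((hs n).sub hf).enorm.pow_const 2) ?_ ?_ ?_
  · simpa using h
  · intro n
    filter_upwards [hC n] with z hz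
    rw [← ofReal_norm, ← ofReal_norm, ← ENNReal.ofReal_pow (norm_nonneg _),
      ← ENNReal.ofReal_pow (norm_nonneg _), ← ENNReal.ofReal_mul (by positivity), ← mul_pow]
    apply ENNReal.ofReal_le_ofReal
    gcongr
    calc ‖s n z - f z‖ ≤ ‖s n z‖ + ‖f z‖ := norm_sub_le _ _
      _ ≤ (C + 1) * ‖f z‖ := by linarith
  · rw [lintegral_const_mul'' _ (hf.enorm.pow_const 2)]
    exact (ENNReal.mul_lt_top ENNReal.ofReal_lt_top hfin).ne
  · filter_upwards [hlim] with z hz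
    have h1 : Tendsto (fun n => ‖s n z - f z‖ₑ ^ 2) atTop (𝓝 (‖f z - f z‖ₑ ^ 2)) :=
      (ENNReal.continuous_pow 2).continuousAt.tendsto.comp
        ((continuous_enorm.continuousAt.tendsto).comp (hz.sub_const _))
    simpa using h1

theorem exists_simpleFunc_approx {f : ℂ → ℂ} (hf : Measurable f) :
    ∃ s : ℕ → SimpleFunc ℂ ℂ, (∀ n z, ‖s n z‖ ≤ 2 * ‖f z‖) ∧
      ∀ z, Tendsto (fun n => s n z) atTop (𝓝 (f z)) := by
  refine ⟨fun n => SimpleFunc.approxOn f hf Set.univ 0 (Set.mem_univ _) n, fun n z => ?_,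
    fun z => SimpleFunc.tendsto_approxOn hf (Set.mem_univ _) (by simp)⟩
  have := SimpleFunc.norm_approxOn_zero_le hf (Set.mem_univ (0 : ℂ)) z n
  linarith

/-! ### Calculus of the graphs of $\int f\,dE$. -/

section Abstract

variable {H : Type*} [NormedAddCommGroup H] [InnerProductSpace ℂ H] [CompleteSpace H]

namespace ResolutionOfIdentity

variable (E : ResolutionOfIdentity H)

theorem edist_simpleIntegral_sq_le (s t : SimpleFunc ℂ ℂ) {f : ℂ → ℂ} (hf : Measurable f) (x : H) :
    edist (E.simpleIntegral s x) (E.simpleIntegral t x) ^ 2 ≤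
      2 * (∫⁻ z, ‖s z - f z‖ₑ ^ 2 ∂(E.measure x) + ∫⁻ z, ‖t z - f z‖ₑ ^ 2 ∂(E.measure x)) := by
  rw [edist_eq_enorm_sub, ← _root_.sub_apply, ← simpleIntegral_sub,
    enorm_simpleIntegral_sq, ← lintegral_add_left (f := fun z => ‖s z - f z‖ₑ ^ 2)
      (((s.measurable.sub hf).enorm).pow_const 2), ← lintegral_const_mul' _ _ (by simp)]
  exact lintegral_mono fun z => enorm_sub_sq_le _ _ _

/-- Membership in the graph quantifies over all dominated simple approximations; a single sequence
converging in $L^2(\langle Ex,x\rangle)$, dominated or not, is enough, since the isometry forces all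
others to the same limit. -/
theorem mem_integralGraph_of_tendsto {f : ℂ → ℂ} (hf : Measurable f) {x y : H}
    (hfin : ∫⁻ z, ‖f z‖ₑ ^ 2 ∂(E.measure x) < ∞) {s : ℕ → SimpleFunc ℂ ℂ}
    (hs : Tendsto (fun n => ∫⁻ z, ‖s n z - f z‖ₑ ^ 2 ∂(E.measure x)) atTop (𝓝 0))
    (hy : Tendsto (fun n => E.simpleIntegral (s n) x) atTop (𝓝 y)) :
    (x, y) ∈ E.integralGraph f := by
  refine ⟨hfin, fun t C hC ht => ?_⟩
  have ht' : Tendsto (fun n => ∫⁻ z, ‖t n z - f z‖ₑ ^ 2 ∂(E.measure x)) atTop (𝓝 0) :=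
    tendsto_lintegral_enorm_sub_sq hf.aemeasurable (fun n => (t n).measurable.aemeasurable)
      hfin (fun n => ae_of_all _ (hC n)) (ae_of_all _ ht)
  have h1 : Tendsto (fun n => edist (E.simpleIntegral (s n) x) (E.simpleIntegral (t n) x))
      atTop (𝓝 0) := by
    apply tendsto_zero_of_sq_tendsto_zero
    refine tendsto_of_tendsto_of_tendsto_of_le_of_le tendsto_const_nhds ?_ (fun _ => bot_le)
      (fun n => E.edist_simpleIntegral_sq_le (s n) (t n) hf x)
    simpa using ENNReal.Tendsto.const_mul (hs.add ht') (Or.inr (by simp : (2 : ℝ≥0∞) ≠ ∞))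
  refine hy.congr_dist ?_
  simp only [dist_edist]
  exact (ENNReal.tendsto_toReal (by simp : (0 : ℝ≥0∞) ≠ ∞)).comp h1

theorem exists_mem_integralGraph {f : ℂ → ℂ} (hf : Measurable f) {x : H}
    (hfin : ∫⁻ z, ‖f z‖ₑ ^ 2 ∂(E.measure x) < ∞) : ∃ y, (x, y) ∈ E.integralGraph f := by
  obtain ⟨s, hC, hs⟩ := exists_simpleFunc_approx hf
  have hs' : Tendsto (fun n => ∫⁻ z, ‖s n z - f z‖ₑ ^ 2 ∂(E.measure x)) atTop (𝓝 0) :=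
    tendsto_lintegral_enorm_sub_sq hf.aemeasurable (fun n => (s n).measurable.aemeasurable)
      hfin (fun n => ae_of_all _ (hC n)) (ae_of_all _ hs)
  have hcau : CauchySeq fun n => E.simpleIntegral (s n) x := by
    rw [EMetric.cauchySeq_iff]
    intro ε hε
    have h1 : Tendsto (fun p : ℕ × ℕ => edist (E.simpleIntegral (s p.1) x)
        (E.simpleIntegral (s p.2) x)) atTop (𝓝 0) := by
      apply tendsto_zero_of_sq_tendsto_zero
      refine tendsto_of_tendsto_of_tendsto_of_le_of_le tendsto_const_nhds ?_ (fun _ => bot_le)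
        (fun n => E.edist_simpleIntegral_sq_le (s n.1) (s n.2) hf x)
      have h2 := (hs'.comp tendsto_fst).add (hs'.comp tendsto_snd)
      rw [prod_atTop_atTop_eq] at h2
      simpa using ENNReal.Tendsto.const_mul h2 (Or.inr (by simp : (2 : ℝ≥0∞) ≠ ∞))
    obtain ⟨⟨N, M⟩, hN⟩ := eventually_atTop.1 (h1.eventually (gt_mem_nhds hε))
    exact ⟨max N M, fun m hm n hn => hN (m, n) ⟨(le_max_left _ _).trans hm,
      (le_max_right _ _).trans hn⟩⟩
  obtain ⟨y, hy⟩ := cauchySeq_tendsto_of_complete hcau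
  exact ⟨y, E.mem_integralGraph_of_tendsto hf hfin hs' hy⟩

variable {E}

theorem eq_of_mem_integralGraph {f : ℂ → ℂ} (hf : Measurable f) {x y y' : H}
    (h : (x, y) ∈ E.integralGraph f) (h' : (x, y') ∈ E.integralGraph f) : y = y' := by
  obtain ⟨s, hC, hs⟩ := exists_simpleFunc_approx hf
  exact tendsto_nhds_unique (h.2 s 2 hC hs) (h'.2 s 2 hC hs)

theorem enorm_sq_of_mem_integralGraph {f : ℂ → ℂ} (hf : Measurable f) {x y : H}
    (h : (x, y) ∈ E.integralGraph f) : ‖y‖ₑ ^ 2 = ∫⁻ z, ‖f z‖ₑ ^ 2 ∂(E.measure x) := by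
  obtain ⟨s, hC, hs⟩ := exists_simpleFunc_approx hf
  have h1 : Tendsto (fun n => ‖E.simpleIntegral (s n) x‖ₑ ^ 2) atTop (𝓝 (‖y‖ₑ ^ 2)) :=
    ((ENNReal.continuous_pow 2).comp continuous_enorm).continuousAt.tendsto.comp (h.2 s 2 hC hs)
  refine tendsto_nhds_unique h1 ?_
  simp only [enorm_simpleIntegral_sq]
  refine tendsto_lintegral_of_dominated_convergence
    (fun z => ENNReal.ofReal (2 ^ 2) * ‖f z‖ₑ ^ 2)
    (fun n => ((s n).measurable.enorm).pow_const 2) (fun n => ae_of_all _ fun z => ?_) ?_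
    (ae_of_all _ fun z => ?_)
  · dsimp only
    rw [← ofReal_norm, ← ofReal_norm, ← ENNReal.ofReal_pow (norm_nonneg _),
      ← ENNReal.ofReal_pow (norm_nonneg _), ← ENNReal.ofReal_mul (by positivity), ← mul_pow]
    apply ENNReal.ofReal_le_ofReal
    gcongr
    exact hC n z
  · rw [lintegral_const_mul _ (hf.enorm.pow_const 2)]
    exact (ENNReal.mul_lt_top ENNReal.ofReal_lt_top h.1).ne
  · exact ((ENNReal.continuous_pow 2).comp continuous_enorm).continuousAt.tendsto.comp (hs z)

theorem add_mem_integralGraph {f g : ℂ → ℂ} (hf : Measurable f) (hg : Measurable g) {x y y' : H}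
    (h : (x, y) ∈ E.integralGraph f) (h' : (x, y') ∈ E.integralGraph g) :
    (x, y + y') ∈ E.integralGraph (fun z => f z + g z) := by
  obtain ⟨s, hsC, hs⟩ := exists_simpleFunc_approx hf
  obtain ⟨t, htC, ht⟩ := exists_simpleFunc_approx hg
  have hs' : Tendsto (fun n => ∫⁻ z, ‖s n z - f z‖ₑ ^ 2 ∂(E.measure x)) atTop (𝓝 0) :=
    tendsto_lintegral_enorm_sub_sq hf.aemeasurable (fun n => (s n).measurable.aemeasurable)
      h.1 (fun n => ae_of_all _ (hsC n)) (ae_of_all _ hs)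
  have ht' : Tendsto (fun n => ∫⁻ z, ‖t n z - g z‖ₑ ^ 2 ∂(E.measure x)) atTop (𝓝 0) :=
    tendsto_lintegral_enorm_sub_sq hg.aemeasurable (fun n => (t n).measurable.aemeasurable)
      h'.1 (fun n => ae_of_all _ (htC n)) (ae_of_all _ ht)
  have hadd : ∀ (a b a' b' : ℂ), ‖a + b - (a' + b')‖ₑ ^ 2 ≤
      2 * (‖a - a'‖ₑ ^ 2 + ‖b - b'‖ₑ ^ 2) := by
    intro a b a' b'
    have := enorm_sub_sq_le (a - a') (b' - b) 0
    simp only [sub_zero] at this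
    rw [enorm_sub_rev b b']
    convert this using 3
    ring
  refine E.mem_integralGraph_of_tendsto (hf.add hg) ?_ (s := fun n => s n + t n) ?_ ?_
  · calc ∫⁻ z, ‖f z + g z‖ₑ ^ 2 ∂(E.measure x)
        ≤ ∫⁻ z, 2 * (‖f z‖ₑ ^ 2 + ‖g z‖ₑ ^ 2) ∂(E.measure x) :=
          lintegral_mono fun z => by simpa using hadd (f z) (g z) 0 0
      _ < ∞ := by
          rw [lintegral_const_mul' _ _ (by simp), lintegral_add_left (hf.enorm.pow_const 2)]
          exact ENNReal.mul_lt_top (by simp) (ENNReal.add_lt_top.2 ⟨h.1, h'.1⟩)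
  · refine tendsto_of_tendsto_of_tendsto_of_le_of_le tendsto_const_nhds
      (h := fun n => 2 * (∫⁻ z, ‖s n z - f z‖ₑ ^ 2 ∂(E.measure x) +
        ∫⁻ z, ‖t n z - g z‖ₑ ^ 2 ∂(E.measure x))) ?_ (fun _ => bot_le) (fun n => ?_)
    · simpa using ENNReal.Tendsto.const_mul (hs'.add ht') (Or.inr (by simp : (2 : ℝ≥0∞) ≠ ∞))
    · dsimp only
      rw [← lintegral_add_left (f := fun z => ‖s n z - f z‖ₑ ^ 2)
        ((((s n).measurable.sub hf).enorm).pow_const 2), ← lintegral_const_mul' _ _ (by simp)]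
      exact lintegral_mono fun z => hadd _ _ _ _
  · simpa [simpleIntegral_add] using (h.2 s 2 hsC hs).add (h'.2 t 2 htC ht)

/-- If $s_n$ approximates $f$ then $t s_n$ approximates $tf$, and the bounded operator $\int t\,dE$
passes through the limit. -/
theorem simpleIntegral_mem_integralGraph {f : ℂ → ℂ} (hf : Measurable f) (t : SimpleFunc ℂ ℂ)
    {x y : H} (h : (x, y) ∈ E.integralGraph f) :
    (x, E.simpleIntegral t y) ∈ E.integralGraph (fun z => t z * f z) := by
  obtain ⟨s, hC, hs⟩ := exists_simpleFunc_approx hf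
  obtain ⟨K, hK⟩ := t.exists_forall_norm_le
  have hfin : ∫⁻ z, ‖t z * f z‖ₑ ^ 2 ∂(E.measure x) < ∞ := by
    refine lt_of_le_of_lt (b := ∫⁻ z, ENNReal.ofReal K ^ 2 * ‖f z‖ₑ ^ 2 ∂(E.measure x))
      (lintegral_mono fun z => ?_) ?_
    · rw [enorm_mul, mul_pow]
      gcongr
      rw [← ofReal_norm]
      exact ENNReal.ofReal_le_ofReal (hK z)
    · rw [lintegral_const_mul' _ _ (by simp)]
      exact ENNReal.mul_lt_top (by simp) h.1
  have hm : Measurable fun z => t z * f z := t.measurable.mul hf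
  refine E.mem_integralGraph_of_tendsto hm hfin (s := fun n => t * s n)
    (tendsto_lintegral_enorm_sub_sq (C := 2) hm.aemeasurable
      (fun n => (t * s n).measurable.aemeasurable)
      hfin (fun n => ae_of_all _ fun z => ?_) (ae_of_all _ fun z => ?_)) ?_
  · rw [SimpleFunc.mul_apply, norm_mul, norm_mul]
    nlinarith [hC n z, norm_nonneg (t z)]
  · simpa using (hs z).const_mul (t z)
  · simp only [simpleIntegral_mul]
    exact (E.simpleIntegral t).continuous.continuousAt.tendsto.comp (h.2 s 2 hC hs)

theorem simpleIntegral_const (a : ℂ) : E.simpleIntegral (SimpleFunc.const ℂ a) = a • 1 := by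
  have := E.simpleIntegral_indicator a MeasurableSet.univ
  rw [E.univ] at this
  rw [← this]
  congr 1
  ext z
  simp

theorem const_mul_mem_integralGraph {f : ℂ → ℂ} (hf : Measurable f) (a : ℂ) {x y : H}
    (h : (x, y) ∈ E.integralGraph f) : (x, a • y) ∈ E.integralGraph (fun z => a * f z) := by
  simpa [simpleIntegral_const] using simpleIntegral_mem_integralGraph hf (SimpleFunc.const ℂ a) h

theorem sub_mem_integralGraph {f g : ℂ → ℂ} (hf : Measurable f) (hg : Measurable g) {x y y' : H}
    (h : (x, y) ∈ E.integralGraph f) (h' : (x, y') ∈ E.integralGraph g) :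
    (x, y - y') ∈ E.integralGraph (fun z => f z - g z) := by
  simpa [sub_eq_add_neg] using add_mem_integralGraph hf (hg.const_mul (-1)) h
    (const_mul_mem_integralGraph hg (-1) h')

variable (E) in
theorem simple_mem_integralGraph (t : SimpleFunc ℂ ℂ) (x : H) :
    (x, E.simpleIntegral t x) ∈ E.integralGraph t := by
  refine E.mem_integralGraph_of_tendsto t.measurable ?_ (s := fun _ => t) (by simp)
    tendsto_const_nhds
  rw [← enorm_simpleIntegral_sq]
  exact ENNReal.pow_lt_top enorm_lt_top

variable (E) in
theorem const_mem_integralGraph (a : ℂ) (x : H) :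
    (x, a • x) ∈ E.integralGraph (fun _ => a) := by
  have h := E.simple_mem_integralGraph (SimpleFunc.const ℂ a) x
  rw [simpleIntegral_const] at h
  exact h

/-- The two image vectors differ by a vector of squared norm $\int|f-g|^2\,d\langle Ex,x\rangle=0$.
-/
theorem mem_integralGraph_congr_ae {f g : ℂ → ℂ} (hf : Measurable f) (hg : Measurable g) {x y : H}
    (h : (x, y) ∈ E.integralGraph f) (hfg : f =ᵐ[E.measure x] g) :
    (x, y) ∈ E.integralGraph g := by
  have hfin : ∫⁻ z, ‖g z‖ₑ ^ 2 ∂(E.measure x) < ∞ := by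
    rw [← lintegral_congr_ae (show (fun z => ‖f z‖ₑ ^ 2) =ᵐ[E.measure x] fun z => ‖g z‖ₑ ^ 2
      from hfg.fun_comp (fun z => ‖z‖ₑ ^ 2))]
    exact h.1
  obtain ⟨y', h'⟩ := E.exists_mem_integralGraph hg hfin
  have h1 := enorm_sq_of_mem_integralGraph (hf.sub hg) (sub_mem_integralGraph hf hg h h')
  have h2 : ∫⁻ z, ‖(f - g) z‖ₑ ^ 2 ∂(E.measure x) = 0 := by
    rw [lintegral_congr_ae (g := fun _ => 0)]
    · simp
    · filter_upwards [hfg] with z hz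
      simp [hz]
  rw [h2] at h1
  have h3 : y = y' := by simpa [sub_eq_zero] using h1
  rwa [h3]

/-- Apply the isometry to $1_B f$, whose integral sends $x$ to $E(B)y$. -/
theorem measure_eq_withDensity_of_mem_integralGraph {f : ℂ → ℂ} (hf : Measurable f) {x y : H}
    (h : (x, y) ∈ E.integralGraph f) :
    E.measure y = (E.measure x).withDensity (fun z => ‖f z‖ₑ ^ 2) := by
  refine Measure.ext fun B hB => ?_
  let t := SimpleFunc.piecewise B hB (SimpleFunc.const ℂ (1 : ℂ)) (SimpleFunc.const ℂ 0)
  have h1 := enorm_sq_of_mem_integralGraph (t.measurable.mul hf)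
    (simpleIntegral_mem_integralGraph hf t h)
  have h2 : E.simpleIntegral t = E.proj B :=
    (E.simpleIntegral_indicator 1 hB).trans (one_smul _ _)
  rw [h2] at h1
  rw [E.measure_apply' y hB, h1, withDensity_apply _ hB, ← lintegral_indicator hB]
  refine lintegral_congr fun z => ?_
  by_cases hz : z ∈ B <;> simp [t, hz]

/-- The composition rule $f(E)\,g(E)x=(fg)(E)x$, including the domain statement. As $\langle
Ey,y\rangle$ has density $|g|^2$, the condition on $y$ becomes one on $fg$ at $x$, and the errors
are $\int|(s_n-f)g|^2\,d\langle Ex,x\rangle$. -/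
theorem mem_integralGraph_of_mul {f g : ℂ → ℂ} (hf : Measurable f) (hg : Measurable g) {x y w : H}
    (h : (x, y) ∈ E.integralGraph g) (h' : (x, w) ∈ E.integralGraph (fun z => f z * g z)) :
    (y, w) ∈ E.integralGraph f := by
  have hfg : Measurable fun z => f z * g z := hf.mul hg
  refine ⟨?_, fun s C hC hs => ?_⟩
  · have := h'.1
    rw [measure_eq_withDensity_of_mem_integralGraph hg h, lintegral_withDensity_eq_lintegral_mul _
      (hg.enorm.pow_const 2) (hf.enorm.pow_const 2)]
    simpa [mul_pow, mul_comm] using this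
  · rw [tendsto_iff_edist_tendsto_0]
    apply tendsto_zero_of_sq_tendsto_zero
    have h1 : ∀ n, edist (E.simpleIntegral (s n) y) w ^ 2 =
        ∫⁻ z, ‖s n z * g z - f z * g z‖ₑ ^ 2 ∂(E.measure x) := fun n => by
      rw [edist_eq_enorm_sub]
      have hm : Measurable fun z => s n z * g z := (s n).measurable.mul hg
      exact enorm_sq_of_mem_integralGraph (hm.sub hfg) (sub_mem_integralGraph hm hfg
        (simpleIntegral_mem_integralGraph hg (s n) h) h')
    simp only [h1]
    refine tendsto_lintegral_enorm_sub_sq (C := C) hfg.aemeasurable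
      (fun n => ((s n).measurable.mul hg).aemeasurable)
      h'.1 (fun n => ae_of_all _ fun z => ?_) (ae_of_all _ fun z => (hs z).mul_const _)
    rw [norm_mul, norm_mul]
    nlinarith [hC n z, norm_nonneg (g z)]

variable (E) in
theorem mem_graph_integral_iff {f : ℂ → ℂ} (hf : Measurable f) (p : H × H) :
    p ∈ (E.integral f).graph ↔ p ∈ E.integralGraph f := by
  rw [integral, Submodule.toLinearPMap_graph_eq]
  rintro ⟨x, y⟩ h rfl
  exact eq_of_mem_integralGraph hf h (E.integralGraph f).zero_mem

end ResolutionOfIdentity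
end Abstract

/-! ### The spectrum of $\int f\,dE$ as an essential range. -/

section Abstract

theorem inResolventSet_iff {H : Type*} [NormedAddCommGroup H] [InnerProductSpace ℂ H]
    {A : H →ₗ.[ℂ] H} {z : ℂ} :
    InResolventSet A z ↔ ∃ R : H →L[ℂ] H, (∀ u, (R u, u + z • R u) ∈ A.graph) ∧
      ∀ v w, (v, w) ∈ A.graph → R (w - z • v) = v := by
  refine exists_congr fun R => and_congr ?_ ?_
  · refine forall_congr' fun u => ?_
    simp only [LinearPMap.mem_graph_iff]
    constructor
    · rintro ⟨v, h1, h2⟩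
      exact ⟨v, h1, by rw [← h1, ← h2]; simp⟩
    · rintro ⟨v, h1, h2⟩
      exact ⟨v, h1, by rw [h2, h1]; simp⟩
  · simp only [LinearPMap.mem_graph_iff]
    constructor
    · rintro h v w ⟨v, rfl, rfl⟩
      exact h v
    · intro h v
      exact h v _ ⟨v, rfl, rfl⟩

variable {H : Type*} [NormedAddCommGroup H] [InnerProductSpace ℂ H] [CompleteSpace H]

namespace ResolutionOfIdentity

variable (E : ResolutionOfIdentity H)

/-- The isometry and $\langle Ex,x\rangle(\mathbb C)=\|x\|^2$ give an everywhere defined integral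
with norm bound $C$; linearity comes from the graph being a single-valued subspace. -/
theorem exists_clm_mem_integralGraph {g : ℂ → ℂ} (hg : Measurable g) {C : ℝ}
    (hC : ∀ z, ‖g z‖ ≤ C) : ∃ R : H →L[ℂ] H, ∀ x, (x, R x) ∈ E.integralGraph g := by
  have hC0 : 0 ≤ C := (norm_nonneg _).trans (hC 0)
  have hle : ∀ x : H, ∫⁻ z, ‖g z‖ₑ ^ 2 ∂(E.measure x) ≤ (ENNReal.ofReal C * ‖x‖ₑ) ^ 2 := by
    intro x
    calc ∫⁻ z, ‖g z‖ₑ ^ 2 ∂(E.measure x) ≤ ∫⁻ _, ENNReal.ofReal C ^ 2 ∂(E.measure x) := by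
          refine lintegral_mono fun z => ?_
          dsimp only
          gcongr
          rw [← ofReal_norm]
          exact ENNReal.ofReal_le_ofReal (hC z)
      _ = _ := by rw [lintegral_const, E.measure_univ, mul_pow]
  have hex : ∀ x : H, ∃ y, (x, y) ∈ E.integralGraph g := fun x =>
    E.exists_mem_integralGraph hg ((hle x).trans_lt
      (ENNReal.pow_lt_top (ENNReal.mul_lt_top (by simp) enorm_lt_top)))
  choose R hR using hex
  have hadd : ∀ x y, R (x + y) = R x + R y := fun x y =>
    eq_of_mem_integralGraph hg (hR (x + y)) (by
      have := (E.integralGraph g).add_mem (hR x) (hR y)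
      rwa [Prod.mk_add_mk] at this)
  have hsmul : ∀ (a : ℂ) x, R (a • x) = a • R x := fun a x =>
    eq_of_mem_integralGraph hg (hR (a • x)) (by
      have := (E.integralGraph g).smul_mem a (hR x)
      rwa [Prod.smul_mk] at this)
  have hbound : ∀ x, ‖R x‖ ≤ C * ‖x‖ := by
    intro x
    have h2 : ‖R x‖ₑ ≤ ENNReal.ofReal C * ‖x‖ₑ := by
      rw [← ENNReal.pow_le_pow_left_iff two_ne_zero, enorm_sq_of_mem_integralGraph hg (hR x)]
      exact hle x
    rw [← ofReal_norm, ← ofReal_norm, ← ENNReal.ofReal_mul hC0] at h2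
    exact (ENNReal.ofReal_le_ofReal_iff (by positivity)).1 h2
  exact ⟨LinearMap.mkContinuous ⟨⟨R, hadd⟩, hsmul⟩ C hbound, hR⟩

theorem measure_eq_zero_of_proj_eq_zero {B : Set ℂ} (hB : MeasurableSet B) (h : E.proj B = 0)
    (x : H) : E.measure x B = 0 := by
  simp [E.measure_apply' x hB, h]

theorem proj_eq_zero_of_measure_eq_zero {B : Set ℂ} (hB : MeasurableSet B)
    (h : ∀ x, E.measure x B = 0) : E.proj B = 0 := by
  ext x
  simpa [E.measure_apply' x hB] using h x

theorem proj_eq_zero_of_subset {B C : Set ℂ} (hB : MeasurableSet B) (hC : MeasurableSet C)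
    (h : B ⊆ C) (h0 : E.proj C = 0) : E.proj B = 0 := by
  rw [← Set.inter_eq_left.2 h, E.inter B C hB hC, h0, mul_zero]

theorem ae_mem_of_proj_eq_self {B : Set ℂ} (hB : MeasurableSet B) {x : H} (hx : E.proj B x = x) :
    ∀ᵐ z ∂(E.measure x), z ∈ B := by
  rw [ae_iff]
  change E.measure x Bᶜ = 0
  rw [E.measure_apply' x hB.compl, ← hx, E.proj_proj hB.compl hB]
  simp [E.proj_empty]

/-- The resolvent is $\int g\,dE$ with $g=(f-a)^{-1}$ off the null set where $|f-a|<\varepsilon$.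
There $g$ is set to $0$, so $|g|\le\varepsilon^{-1}$ everywhere. -/
theorem inResolventSet_integral {f : ℂ → ℂ} (hf : Measurable f) {a : ℂ} {ε : ℝ} (hε : 0 < ε)
    (h : E.proj (f ⁻¹' Metric.ball a ε) = 0) : InResolventSet (E.integral f) a := by
  classical
  have hN : MeasurableSet (f ⁻¹' Metric.ball a ε) := hf Metric.isOpen_ball.measurableSet
  let g : ℂ → ℂ := fun z => if z ∈ f ⁻¹' Metric.ball a ε then 0 else (f z - a)⁻¹
  have hg : Measurable g := Measurable.ite hN measurable_const (hf.sub_const a).inv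
  have hgC : ∀ z, ‖g z‖ ≤ ε⁻¹ := by
    intro z
    by_cases hz : z ∈ f ⁻¹' Metric.ball a ε
    · simp only [g, hz, if_true, norm_zero]
      positivity
    · simp only [g, hz, if_false, norm_inv]
      rw [Set.mem_preimage, Metric.mem_ball, dist_eq_norm, not_lt] at hz
      exact inv_anti₀ hε hz
  have hfg : ∀ x, ∀ᵐ z ∂(E.measure x), (f z - a) * g z = 1 := by
    intro x
    have h0 := E.measure_eq_zero_of_proj_eq_zero hN h x
    filter_upwards [measure_eq_zero_iff_ae_notMem.1 h0] with z hz
    have hne : f z - a ≠ 0 := by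
      intro h1
      apply hz
      rw [Set.mem_preimage, sub_eq_zero.1 h1]
      exact Metric.mem_ball_self hε
    simp only [g, hz, if_false]
    exact mul_inv_cancel₀ hne
  obtain ⟨R, hR⟩ := E.exists_clm_mem_integralGraph hg hgC
  rw [inResolventSet_iff]
  refine ⟨R, fun u => ?_, fun v w hvw => ?_⟩
  · rw [E.mem_graph_integral_iff hf]
    refine mem_integralGraph_of_mul hf hg (hR u) ?_
    have h1 := add_mem_integralGraph measurable_const (hg.const_mul a)
      (E.const_mem_integralGraph 1 u) (const_mul_mem_integralGraph hg a (hR u))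
    rw [one_smul] at h1
    refine mem_integralGraph_congr_ae (measurable_const.add (hg.const_mul a)) (hf.mul hg) h1 ?_
    filter_upwards [hfg u] with z hz
    change 1 + a * g z = f z * g z
    linear_combination (-1) * hz
  · rw [E.mem_graph_integral_iff hf] at hvw
    have h1 := sub_mem_integralGraph hf measurable_const hvw (E.const_mem_integralGraph a v)
    refine eq_of_mem_integralGraph hg (hR _) (mem_integralGraph_of_mul hg (hf.sub_const a) h1 ?_)
    have h2 := E.const_mem_integralGraph 1 v
    rw [one_smul] at h2
    refine mem_integralGraph_congr_ae measurable_const (hg.mul (hf.sub_const a)) h2 ?_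
    filter_upwards [hfg v] with z hz
    change 1 = g z * (f z - a)
    rw [← hz, mul_comm]

/-- Nonzero vectors in the range of $E(f^{-1}(B(a,\varepsilon)))$ are approximate eigenvectors:
$\|(f(E)-a)x\|\le\varepsilon\|x\|$. A bounded inverse excludes this for small $\varepsilon$. -/
theorem not_inResolventSet_integral {f : ℂ → ℂ} (hf : Measurable f) {a : ℂ}
    (h : ∀ ε > 0, E.proj (f ⁻¹' Metric.ball a ε) ≠ 0) : ¬ InResolventSet (E.integral f) a := by
  rw [inResolventSet_iff]
  rintro ⟨R, -, hR⟩
  -- Chosen so that $\|R\|\varepsilon<1$, which contradicts $\|x\|\le\|R\|\varepsilon\|x\|$.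
  let ε : ℝ := (‖R‖ + 1)⁻¹
  have hε : 0 < ε := by positivity
  have hN : MeasurableSet (f ⁻¹' Metric.ball a ε) := hf Metric.isOpen_ball.measurableSet
  obtain ⟨u, hu⟩ : ∃ u, E.proj (f ⁻¹' Metric.ball a ε) u ≠ 0 := by
    by_contra! hcon
    exact h ε hε (ContinuousLinearMap.ext hcon)
  set x := E.proj (f ⁻¹' Metric.ball a ε) u with hx
  have hxx : E.proj (f ⁻¹' Metric.ball a ε) x = x := by
    rw [hx, E.proj_proj hN hN, Set.inter_self]
  have hae := E.ae_mem_of_proj_eq_self hN hxx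
  have hle : ∫⁻ z, ‖f z - a‖ₑ ^ 2 ∂(E.measure x) ≤ (ENNReal.ofReal ε * ‖x‖ₑ) ^ 2 := by
    calc ∫⁻ z, ‖f z - a‖ₑ ^ 2 ∂(E.measure x) ≤ ∫⁻ _, ENNReal.ofReal ε ^ 2 ∂(E.measure x) := by
          refine lintegral_mono_ae ?_
          filter_upwards [hae] with z hz
          gcongr
          rw [← ofReal_norm, ← dist_eq_norm]
          exact ENNReal.ofReal_le_ofReal (Metric.mem_ball.1 hz).le
      _ = _ := by rw [lintegral_const, E.measure_univ, mul_pow]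
  obtain ⟨y, hy⟩ := E.exists_mem_integralGraph (hf.sub_const a) (hle.trans_lt
      (ENNReal.pow_lt_top (ENNReal.mul_lt_top (by simp) enorm_lt_top)))
  have h1 := add_mem_integralGraph (hf.sub_const a) measurable_const hy
    (E.const_mem_integralGraph a x)
  simp only [sub_add_cancel] at h1
  have h2 := hR x _ ((E.mem_graph_integral_iff hf _).2 h1)
  rw [add_sub_cancel_right] at h2
  have h3 : ‖y‖ₑ ≤ ENNReal.ofReal ε * ‖x‖ₑ := by
    rw [← ENNReal.pow_le_pow_left_iff two_ne_zero,
      enorm_sq_of_mem_integralGraph (hf.sub_const a) hy]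
    exact hle
  rw [← ofReal_norm, ← ofReal_norm, ← ENNReal.ofReal_mul hε.le,
    ENNReal.ofReal_le_ofReal_iff (by positivity)] at h3
  have h4 : ‖x‖ ≤ ‖R‖ * (ε * ‖x‖) := by
    calc ‖x‖ = ‖R y‖ := by rw [h2]
      _ ≤ ‖R‖ * ‖y‖ := R.le_opNorm y
      _ ≤ _ := by gcongr
  have h5 : 0 < ‖x‖ := norm_pos_iff.2 hu
  have h6 : ‖R‖ * ε < 1 := by
    rw [← div_eq_mul_inv, div_lt_one (by positivity)]
    linarith
  nlinarith

/-- The spectrum of `∫ f dE` is the essential range of `f`. -/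
theorem opSpectrum_integral {f : ℂ → ℂ} (hf : Measurable f) :
    opSpectrum (E.integral f) = {a | ∀ ε > 0, E.proj (f ⁻¹' Metric.ball a ε) ≠ 0} := by
  ext a
  constructor
  · intro h ε hε h0
    exact h (E.inResolventSet_integral hf hε h0)
  · intro h
    exact E.not_inResolventSet_integral hf h

end ResolutionOfIdentity
end Abstract

/-! ### Multiplication operators on $L^2$ as spectral integrals. -/

section Multiplication

variable {α : Type*} [MeasurableSpace α] {μ : Measure α}

theorem eLpNorm_two_sq (f : α → ℂ) : eLpNorm f 2 μ ^ 2 = ∫⁻ a, ‖f a‖ₑ ^ 2 ∂μ := by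
  have := eLpNorm_nnreal_pow_eq_lintegral (f := f) (μ := μ) (p := 2) two_ne_zero
  simpa using this

theorem enorm_sq_eq_lintegral (f : Lp ℂ 2 μ) : ‖f‖ₑ ^ 2 = ∫⁻ a, ‖f a‖ₑ ^ 2 ∂μ := by
  rw [Lp.enorm_def, eLpNorm_two_sq]

theorem memLp_two_of_lintegral {f : α → ℂ} (hf : AEStronglyMeasurable f μ)
    (h : ∫⁻ a, ‖f a‖ₑ ^ 2 ∂μ < ∞) : MemLp f 2 μ := by
  refine ⟨hf, ?_⟩
  rw [← eLpNorm_two_sq] at h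
  by_contra hcon
  rw [not_lt, top_le_iff] at hcon
  simp [hcon] at h

/-- Multiplication by the indicator function of a measurable set on `L²`. -/
def mulIndicator {S : Set α} (hS : MeasurableSet S) : Lp ℂ 2 μ →L[ℂ] Lp ℂ 2 μ :=
  LinearMap.mkContinuous
    { toFun := fun f => ((Lp.memLp f).indicator hS).toLp
      map_add' := fun f g => by
        apply Lp.ext
        filter_upwards [((Lp.memLp (f + g)).indicator hS).coeFn_toLp,
          ((Lp.memLp f).indicator hS).coeFn_toLp, ((Lp.memLp g).indicator hS).coeFn_toLp,
          Lp.coeFn_add f g, Lp.coeFn_add ((Lp.memLp f).indicator hS).toLp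
            ((Lp.memLp g).indicator hS).toLp] with a h1 h2 h3 h4 h5
        rw [h1, h5, Pi.add_apply, h2, h3]
        by_cases ha : a ∈ S <;> simp only [ha, Set.indicator_of_mem, Set.indicator_of_notMem,
          not_false_eq_true, h4, Pi.add_apply, add_zero]
      map_smul' := fun c f => by
        apply Lp.ext
        filter_upwards [((Lp.memLp (c • f)).indicator hS).coeFn_toLp,
          ((Lp.memLp f).indicator hS).coeFn_toLp, Lp.coeFn_smul c f,
          Lp.coeFn_smul c ((Lp.memLp f).indicator hS).toLp] with a h1 h2 h3 h4
        by_cases ha : a ∈ S <;> simp [h1, h2, h3, h4, ha] }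
    1 (fun f => by
      rw [one_mul]
      refine Lp.norm_le_norm_of_ae_le ?_
      filter_upwards [((Lp.memLp f).indicator hS).coeFn_toLp] with a h
      refine (congrArg norm h).trans_le ?_
      exact norm_indicator_le_norm_self _ _)

theorem coeFn_mulIndicator {S : Set α} (hS : MeasurableSet S) (f : Lp ℂ 2 μ) :
    mulIndicator hS f =ᵐ[μ] S.indicator f :=
  ((Lp.memLp f).indicator hS).coeFn_toLp

theorem mulIndicator_congr {S T : Set α} (hS : MeasurableSet S) (hT : MeasurableSet T)
    (h : S = T) (f : Lp ℂ 2 μ) : mulIndicator hS f = mulIndicator hT f := by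
  subst h; rfl

theorem mulIndicator_mulIndicator {S T : Set α} (hS : MeasurableSet S) (hT : MeasurableSet T)
    (f : Lp ℂ 2 μ) : mulIndicator hS (mulIndicator hT f) = mulIndicator (hS.inter hT) f := by
  apply Lp.ext
  filter_upwards [coeFn_mulIndicator hS (mulIndicator hT f), coeFn_mulIndicator hT f,
    coeFn_mulIndicator (hS.inter hT) f] with a h1 h2 h3
  by_cases h4 : a ∈ S <;> by_cases h5 : a ∈ T <;> simp [h1, h2, h3, h4, h5]

theorem mulIndicator_univ (f : Lp ℂ 2 μ) : mulIndicator MeasurableSet.univ f = f := by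
  apply Lp.ext
  filter_upwards [coeFn_mulIndicator MeasurableSet.univ f] with a h1
  simp [h1]

theorem mulIndicator_union {S T : Set α} (hS : MeasurableSet S) (hT : MeasurableSet T)
    (h : Disjoint S T) (f : Lp ℂ 2 μ) :
    mulIndicator (hS.union hT) f = mulIndicator hS f + mulIndicator hT f := by
  apply Lp.ext
  filter_upwards [coeFn_mulIndicator (hS.union hT) f, coeFn_mulIndicator hS f,
    coeFn_mulIndicator hT f, Lp.coeFn_add (mulIndicator hS f) (mulIndicator hT f)]
    with a h1 h2 h3 h4
  rw [h4, Pi.add_apply, h1, h2, h3, Set.indicator_union_of_disjoint h]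

theorem enorm_mulIndicator_sq {S : Set α} (hS : MeasurableSet S) (f : Lp ℂ 2 μ) :
    ‖mulIndicator hS f‖ₑ ^ 2 = μ.withDensity (fun a => ‖f a‖ₑ ^ 2) S := by
  rw [enorm_sq_eq_lintegral, withDensity_apply _ hS, ← lintegral_indicator hS]
  refine lintegral_congr_ae ?_
  filter_upwards [coeFn_mulIndicator hS f] with a h
  by_cases ha : a ∈ S <;> simp [h, ha]

theorem sum_mulIndicator {S : ℕ → Set α} (hS : ∀ n, MeasurableSet (S n))
    (hd : Pairwise (fun i j => Disjoint (S i) (S j))) (f : Lp ℂ 2 μ) (t : Finset ℕ) :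
    ∑ n ∈ t, mulIndicator (hS n) f =
      mulIndicator (t.measurableSet_biUnion fun n _ => hS n) f := by
  classical
  induction t using Finset.induction_on with
  | empty =>
    apply Lp.ext
    filter_upwards [coeFn_mulIndicator (Finset.measurableSet_biUnion ∅ fun n _ => hS n) f,
      Lp.coeFn_zero ℂ 2 μ] with a h1 h2
    rw [Finset.sum_empty, h1, h2]
    simp
  | insert m t hm ih =>
    rw [Finset.sum_insert hm, ih, ← mulIndicator_union]
    · congr 1
      simp
    · rw [Set.disjoint_iUnion₂_right]
      intro n hn
      exact hd (by rintro rfl; exact hm hn)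

/-- With the finite measure $\nu=|f|^2\mu$, the squared distance of a partial sum to the limit is
$\nu(\bigcup_n S_n)-\sum_{n\in t}\nu(S_n)$, so countable additivity of $\nu$ gives convergence. -/
theorem hasSum_mulIndicator {S : ℕ → Set α} (hS : ∀ n, MeasurableSet (S n))
    (hd : Pairwise (fun i j => Disjoint (S i) (S j))) (f : Lp ℂ 2 μ) :
    HasSum (fun n => mulIndicator (hS n) f) (mulIndicator (MeasurableSet.iUnion hS) f) := by
  set ν := μ.withDensity (fun a => ‖f a‖ₑ ^ 2) with hν
  have hfin : ∀ S, ν S ≠ ∞ := fun S => by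
    refine ne_top_of_le_ne_top ?_ (measure_mono (Set.subset_univ S))
    rw [hν, ← enorm_mulIndicator_sq MeasurableSet.univ]
    exact (ENNReal.pow_lt_top enorm_lt_top).ne
  rw [HasSum, SummationFilter.unconditional_filter, tendsto_iff_edist_tendsto_0]
  apply tendsto_zero_of_sq_tendsto_zero
  have h1 : ∀ t : Finset ℕ, edist (∑ n ∈ t, mulIndicator (hS n) f)
      (mulIndicator (MeasurableSet.iUnion hS) f) ^ 2 = ν (⋃ n, S n) - ∑ n ∈ t, ν (S n) := by
    intro t
    have hm := t.measurableSet_biUnion fun n _ => hS n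
    have hsub : ⋃ n ∈ t, S n ⊆ ⋃ n, S n := Set.iUnion₂_subset_iUnion _ _
    have hdiff := (MeasurableSet.iUnion hS).diff hm
    have h2 : mulIndicator (MeasurableSet.iUnion hS) f =
        mulIndicator hm f + mulIndicator hdiff f := by
      rw [← mulIndicator_union hm hdiff Set.disjoint_sdiff_right]
      exact mulIndicator_congr _ _ (Set.union_sdiff_cancel hsub).symm f
    rw [sum_mulIndicator hS hd, edist_comm, edist_eq_enorm_sub, h2, add_sub_cancel_left,
      enorm_mulIndicator_sq, ← measure_biUnion_finset (fun i _ j _ hij => hd hij)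
        (fun n _ => hS n), measure_sdiff hsub hm.nullMeasurableSet (hfin _)]
  simp only [h1]
  have h3 : Tendsto (fun t : Finset ℕ => ∑ n ∈ t, ν (S n)) atTop (𝓝 (ν (⋃ n, S n))) := by
    rw [measure_iUnion hd hS]
    exact ENNReal.summable.hasSum
  have h4 := ENNReal.Tendsto.sub (tendsto_const_nhds (x := ν (⋃ n, S n))) h3 (Or.inl (hfin _))
  simpa using h4

theorem inner_mulIndicator {S : Set α} (hS : MeasurableSet S) (f g : Lp ℂ 2 μ) :
    inner ℂ (mulIndicator hS f) g = inner ℂ f (mulIndicator hS g) := by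
  rw [L2.inner_def, L2.inner_def]
  refine integral_congr_ae ?_
  filter_upwards [coeFn_mulIndicator hS f, coeFn_mulIndicator hS g] with a h1 h2
  by_cases ha : a ∈ S <;> simp [h1, h2, ha]

variable {H : Type*} [NormedAddCommGroup H] [InnerProductSpace ℂ H]

/-- The operator on `H` that corresponds under the unitary map `U` to multiplication by the
indicator function of `S`. -/
def conjIndicator (U : H ≃ₗᵢ[ℂ] Lp ℂ 2 μ) {S : Set α} (hS : MeasurableSet S) : H →L[ℂ] H :=
  (U.symm.toContinuousLinearEquiv : Lp ℂ 2 μ →L[ℂ] H) ∘L mulIndicator hS ∘L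
    (U.toContinuousLinearEquiv : H →L[ℂ] Lp ℂ 2 μ)

theorem conjIndicator_apply (U : H ≃ₗᵢ[ℂ] Lp ℂ 2 μ) {S : Set α} (hS : MeasurableSet S) (x : H) :
    conjIndicator U hS x = U.symm (mulIndicator hS (U x)) := rfl

variable [CompleteSpace H]

open Classical in
/-- The resolution of the identity of the operator that corresponds under the unitary map `U` to
multiplication by `φ`. -/
def multiplicationResolution (U : H ≃ₗᵢ[ℂ] Lp ℂ 2 μ) {φ : α → ℂ} (hφ : Measurable φ) :
    ResolutionOfIdentity H where
  proj B := if hB : MeasurableSet B then conjIndicator U (hφ hB) else 0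
  not_measurable B hB := dif_neg hB
  isStarProjection B hB := by
    rw [dif_pos hB]
    refine ⟨?_, ?_⟩
    · ext x
      change conjIndicator U (hφ hB) (conjIndicator U (hφ hB) x) = _
      simp [conjIndicator_apply, mulIndicator_mulIndicator]
    · rw [ContinuousLinearMap.isSelfAdjoint_iff_isSymmetric]
      intro x y
      simp only [ContinuousLinearMap.coe_coe, conjIndicator_apply]
      rw [← U.inner_map_map, ← U.inner_map_map x]
      simp [inner_mulIndicator]
  univ := by
    rw [dif_pos MeasurableSet.univ]
    ext x
    simp [conjIndicator_apply, mulIndicator_univ]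
  inter B C hB hC := by
    rw [dif_pos hB, dif_pos hC, dif_pos (hB.inter hC)]
    ext x
    change _ = conjIndicator U (hφ hB) (conjIndicator U (hφ hC) x)
    simp [conjIndicator_apply, mulIndicator_mulIndicator]
  iUnion B hB hd x := by
    simp only [hB, MeasurableSet.iUnion hB, dif_pos, conjIndicator_apply]
    have h := hasSum_mulIndicator (fun n => hφ (hB n)) (fun i j hij => (hd hij).preimage φ) (U x)
    have h2 := h.mapL (U.symm.toContinuousLinearEquiv : Lp ℂ 2 μ →L[ℂ] H)
    refine Eq.subst (motive := HasSum _) ?_ h2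
    exact congrArg U.symm (mulIndicator_congr _ _ Set.preimage_iUnion.symm _)

variable (U : H ≃ₗᵢ[ℂ] Lp ℂ 2 μ) {φ : α → ℂ} (hφ : Measurable φ)

theorem multiplicationResolution_proj {B : Set ℂ} (hB : MeasurableSet B) (x : H) :
    U ((multiplicationResolution U hφ).proj B x) = mulIndicator (hφ hB) (U x) := by
  simp [multiplicationResolution, hB, conjIndicator_apply]

theorem multiplicationResolution_measure (x : H) :
    (multiplicationResolution U hφ).measure x =
      (μ.withDensity (fun a => ‖U x a‖ₑ ^ 2)).map φ := by
  refine Measure.ext fun B hB => ?_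
  rw [ResolutionOfIdentity.measure_apply' _ x hB, Measure.map_apply hφ hB,
    ← enorm_mulIndicator_sq (hφ hB), ← multiplicationResolution_proj U hφ hB,
    U.enorm_map]

theorem lintegral_multiplicationResolution {f : ℂ → ℂ} (hf : Measurable f) (x : H) :
    ∫⁻ z, ‖f z‖ₑ ^ 2 ∂((multiplicationResolution U hφ).measure x) =
      ∫⁻ a, ‖f (φ a) * U x a‖ₑ ^ 2 ∂μ := by
  rw [multiplicationResolution_measure, lintegral_map (hf.enorm.pow_const 2) hφ,
    lintegral_withDensity_eq_lintegral_mul₀ ((Lp.aestronglyMeasurable _).enorm.pow_const 2)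
      (g := fun a => ‖f (φ a)‖ₑ ^ 2) ((hf.comp hφ).enorm.pow_const 2).aemeasurable]
  simp [mul_pow, mul_comm]

theorem multiplicationResolution_simpleIntegral (s : SimpleFunc ℂ ℂ) (x : H) :
    U ((multiplicationResolution U hφ).simpleIntegral s x) =ᵐ[μ] fun a => s (φ a) * U x a := by
  induction s using SimpleFunc.induction with
  | const c hB =>
    rename_i B
    rw [ResolutionOfIdentity.simpleIntegral_indicator, _root_.smul_apply, map_smul,
      multiplicationResolution_proj U hφ hB]
    filter_upwards [Lp.coeFn_smul c (mulIndicator (hφ hB) (U x)),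
      coeFn_mulIndicator (hφ hB) (U x)] with a h1 h2
    rw [h1, Pi.smul_apply, h2]
    by_cases ha : φ a ∈ B <;> simp [ha]
  | add _ hf hg =>
    rename_i f g _
    rw [ResolutionOfIdentity.simpleIntegral_add, _root_.add_apply, map_add]
    filter_upwards [Lp.coeFn_add (U ((multiplicationResolution U hφ).simpleIntegral f x))
      (U ((multiplicationResolution U hφ).simpleIntegral g x)), hf, hg] with a h1 h2 h3
    rw [h1, Pi.add_apply, h2, h3, SimpleFunc.coe_add, Pi.add_apply, add_mul]

/-- Identifies $\int f\,dE$ with maximal multiplication by $f\circ\varphi$. Dominated convergence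
gives the backward direction. For the forward one, finiteness puts $(f\circ\varphi)\,Ux$ in $L^2$,
the backward direction applies to its preimage, and the graph is single-valued. -/
theorem mem_integralGraph_multiplicationResolution_iff {f : ℂ → ℂ} (hf : Measurable f) {x y : H} :
    (x, y) ∈ (multiplicationResolution U hφ).integralGraph f ↔
      U y =ᵐ[μ] fun a => f (φ a) * U x a := by
  have hm : AEStronglyMeasurable (fun a => f (φ a) * U x a) μ :=
    (hf.comp hφ).aestronglyMeasurable.mul (Lp.aestronglyMeasurable _)
  have key : ∀ y, U y =ᵐ[μ] (fun a => f (φ a) * U x a) →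
      (x, y) ∈ (multiplicationResolution U hφ).integralGraph f := by
    intro y hy
    have hy' : ∫⁻ a, ‖f (φ a) * U x a‖ₑ ^ 2 ∂μ < ∞ := by
      rw [← lintegral_congr_ae (show (fun a => ‖U y a‖ₑ ^ 2) =ᵐ[μ]
        fun a => ‖f (φ a) * U x a‖ₑ ^ 2 from hy.fun_comp (fun z => ‖z‖ₑ ^ 2)), ← enorm_sq_eq_lintegral]
      exact ENNReal.pow_lt_top enorm_lt_top
    refine ⟨by rwa [lintegral_multiplicationResolution U hφ hf], fun s C hC hs => ?_⟩
    rw [tendsto_iff_edist_tendsto_0]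
    apply tendsto_zero_of_sq_tendsto_zero
    have h1 : ∀ n, edist ((multiplicationResolution U hφ).simpleIntegral (s n) x) y ^ 2 =
        ∫⁻ a, ‖s n (φ a) * U x a - f (φ a) * U x a‖ₑ ^ 2 ∂μ := fun n => by
      rw [edist_eq_enorm_sub, ← U.enorm_map, map_sub, enorm_sq_eq_lintegral]
      refine lintegral_congr_ae ?_
      filter_upwards [Lp.coeFn_sub (U ((multiplicationResolution U hφ).simpleIntegral (s n) x))
        (U y), multiplicationResolution_simpleIntegral U hφ (s n) x, hy] with a h1 h2 h3
      rw [h1, Pi.sub_apply, h2, h3]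
    simp only [h1]
    refine tendsto_lintegral_enorm_sub_sq (C := C) hm.aemeasurable (fun n =>
      (((s n).measurable.comp hφ).aestronglyMeasurable.mul
        (Lp.aestronglyMeasurable _)).aemeasurable) hy'
      (fun n => ae_of_all _ fun a => ?_) (ae_of_all _ fun a => (hs (φ a)).mul_const _)
    rw [norm_mul, norm_mul]
    nlinarith [hC n (φ a), norm_nonneg (U x a)]
  refine ⟨fun h => ?_, key y⟩
  have hfin := h.1
  rw [lintegral_multiplicationResolution U hφ hf] at hfin
  have hL := memLp_two_of_lintegral hm hfin
  have h1 := key (U.symm hL.toLp) (by simpa using hL.coeFn_toLp)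
  rw [ResolutionOfIdentity.eq_of_mem_integralGraph hf h h1]
  simpa using hL.coeFn_toLp

end Multiplication

/-! ### The $L^2$ Fourier transform and locally absolutely continuous functions. -/

section Fourier

open FourierTransform SchwartzMap
open scoped ContDiff

theorem continuous_fourierInv {f : ℝ → ℂ} (hf : Integrable f) : Continuous (𝓕⁻ f) :=
  VectorFourier.fourierIntegral_continuous Real.continuous_fourierChar
    (by simpa using! continuous_inner.neg) hf

/-- The inverse Fourier transform on `L²` is given by the integral on `L¹ ∩ L²`. -/
theorem fourierInv_toLp_ae_eq {f : ℝ → ℂ} (h1 : Integrable f) (h2 : MemLp f 2) :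
    ((𝓕⁻ h2.toLp : Lp ℂ 2 (volume : Measure ℝ)) : ℝ → ℂ) =ᵐ[volume] 𝓕⁻ f := by
  refine ae_eq_of_integral_contDiff_smul_eq
    ((Lp.memLp _).locallyIntegrable (by norm_num))
    (continuous_fourierInv h1).locallyIntegrable ?_
  -- Both sides are tested against $g$, viewed as a Schwartz function $G$. The transform moves onto
  -- $G$ by duality of tempered distributions for the $L^2$ version, and by Fubini for the integral.
  intro g g_smooth g_cpt
  have hg₁ : HasCompactSupport (Complex.ofRealCLM ∘ g) := g_cpt.comp_left rfl
  have hg₂ : ContDiff ℝ ∞ (Complex.ofRealCLM ∘ g) := by fun_prop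
  set G : 𝓢(ℝ, ℂ) := hg₁.toSchwartzMap hg₂ with hG
  have e1 : ∫ x, g x • (𝓕⁻ h2.toLp : Lp ℂ 2 (volume : Measure ℝ)) x =
      (Lp.toTemperedDistribution (𝓕⁻ h2.toLp : Lp ℂ 2 (volume : Measure ℝ))) G := by
    rw [Lp.toTemperedDistribution_apply]
    simp [hG]
  have e2 : ∫ x, 𝓕⁻ G x • h2.toLp f x = ∫ x, 𝓕⁻ G x • f x := by
    refine integral_congr_ae ?_
    filter_upwards [h2.coeFn_toLp] with x hx
    rw [hx]
  rw [e1, ← Lp.fourierInv_toTemperedDistribution_eq, TemperedDistribution.fourierInv_apply,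
    Lp.toTemperedDistribution_apply, e2]
  have e3 := VectorFourier.integral_fourierIntegral_smul_eq_flip (L := -innerₗ ℝ) (μ := volume)
    (ν := volume) Real.continuous_fourierChar (by simpa using! continuous_inner.neg)
    G.integrable h1
  have e4 : (-innerₗ ℝ).flip = -innerₗ ℝ := by ext; simp
  rw [e4] at e3
  simp only [SchwartzMap.fourierInv_coe]
  refine e3.trans ?_
  refine integral_congr_ae (ae_of_all _ fun x => ?_)
  exact (Complex.real_smul (x := g x)).symm

/-- The Fourier transform on `L²` is given by the integral on `L¹ ∩ L²`. -/
theorem fourier_toLp_ae_eq {f : ℝ → ℂ} (h1 : Integrable f) (h2 : MemLp f 2) :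
    ((𝓕 h2.toLp : Lp ℂ 2 (volume : Measure ℝ)) : ℝ → ℂ) =ᵐ[volume] 𝓕 f := by
  refine ae_eq_of_integral_contDiff_smul_eq
    ((Lp.memLp _).locallyIntegrable (by norm_num))
    (VectorFourier.fourierIntegral_continuous Real.continuous_fourierChar
      (by simpa using! continuous_inner) h1).locallyIntegrable ?_
  intro g g_smooth g_cpt
  have hg₁ : HasCompactSupport (Complex.ofRealCLM ∘ g) := g_cpt.comp_left rfl
  have hg₂ : ContDiff ℝ ∞ (Complex.ofRealCLM ∘ g) := by fun_prop
  set G : 𝓢(ℝ, ℂ) := hg₁.toSchwartzMap hg₂ with hG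
  have e1 : ∫ x, g x • (𝓕 h2.toLp : Lp ℂ 2 (volume : Measure ℝ)) x =
      (Lp.toTemperedDistribution (𝓕 h2.toLp : Lp ℂ 2 (volume : Measure ℝ))) G := by
    rw [Lp.toTemperedDistribution_apply]
    simp [hG]
  have e2 : ∫ x, 𝓕 G x • h2.toLp f x = ∫ x, 𝓕 G x • f x := by
    refine integral_congr_ae ?_
    filter_upwards [h2.coeFn_toLp] with x hx
    rw [hx]
  rw [e1, ← Lp.fourier_toTemperedDistribution_eq, TemperedDistribution.fourier_apply,
    Lp.toTemperedDistribution_apply, e2]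
  have e3 := VectorFourier.integral_fourierIntegral_smul_eq_flip (L := innerₗ ℝ) (μ := volume)
    (ν := volume) Real.continuous_fourierChar (by simpa using! continuous_inner)
    G.integrable h1
  rw [flip_innerₗ] at e3
  simp only [SchwartzMap.fourier_coe]
  refine e3.trans ?_
  refine integral_congr_ae (ae_of_all _ fun x => ?_)
  exact (Complex.real_smul (x := g x)).symm

theorem absolutelyContinuousOnInterval_ofReal {f : ℝ → ℝ} {a b : ℝ}
    (hf : AbsolutelyContinuousOnInterval f a b) :
    AbsolutelyContinuousOnInterval (fun t => (f t : ℂ)) a b := by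
  have h1 : AbsolutelyContinuousOnInterval (fun _ : ℝ => (1 : ℂ)) a b :=
    contDiffOn_const.absolutelyContinuousOnInterval
  have h2 := hf.smul h1
  have h3 : (fun t => (f t : ℂ)) = f • fun _ : ℝ => (1 : ℂ) := by
    ext t : 1
    simp
  rw [h3]
  exact h2

theorem locallyAC_integral {r : ℝ → ℂ} (hr : LocallyIntegrable r) :
    LocallyAC (fun t => ∫ u in (0 : ℝ)..t, r u) := by
  intro a b
  have hint : ∀ a b, IntervalIntegrable r volume a b := fun a b =>
    intervalIntegrable_iff.mpr <|
      (hr.integrableOn_isCompact isCompact_uIcc).mono_set Set.uIoc_subset_uIcc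
  -- $[-N,N]$ contains $a$, $b$ and the base point $0$ of the primitive.
  set N := max |a| |b| with hN
  have ha := abs_le.1 (le_max_left |a| |b|)
  have hb := abs_le.1 (le_max_right |a| |b|)
  have hN0 : 0 ≤ N := (abs_nonneg a).trans (le_max_left _ _)
  have h0 : (0 : ℝ) ∈ Set.uIcc (-N) N := by
    rw [Set.uIcc_of_le (by linarith)]; exact ⟨by linarith, hN0⟩
  have hsub : Set.uIcc a b ⊆ Set.uIcc (-N) N :=
    Set.uIcc_subset_uIcc (by rw [Set.uIcc_of_le (by linarith)]; exact ha)
      (by rw [Set.uIcc_of_le (by linarith)]; exact hb)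
  have hre : IntervalIntegrable (fun u => (r u).re) volume (-N) N :=
    ⟨(hint _ _).1.re, (hint _ _).2.re⟩
  have him : IntervalIntegrable (fun u => (r u).im) volume (-N) N :=
    ⟨(hint _ _).1.im, (hint _ _).2.im⟩
  have h1 := absolutelyContinuousOnInterval_ofReal
    (hre.absolutelyContinuousOnInterval_intervalIntegral h0)
  have h2 := absolutelyContinuousOnInterval_ofReal
    (him.absolutelyContinuousOnInterval_intervalIntegral h0)
  have h3 := (h1.add (h2.const_smul Complex.I)).mono hsub
  refine Eq.subst (motive := fun g => AbsolutelyContinuousOnInterval g a b) ?_ h3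
  ext t : 1
  simp only [Pi.add_apply, smul_eq_mul]
  rw [← intervalIntegral.integral_ofReal, ← intervalIntegral.integral_ofReal,
    ← intervalIntegral.integral_const_mul, ← intervalIntegral.integral_add]
  · refine intervalIntegral.integral_congr fun u _ => ?_
    rw [mul_comm, Complex.re_add_im]
  · exact ⟨(hint _ _).1.re.ofReal, (hint _ _).2.re.ofReal⟩
  · exact ⟨(hint _ _).1.im.ofReal.const_mul _, (hint _ _).2.im.ofReal.const_mul _⟩

theorem locallyAC_of_sub_eq_integral {g r : ℝ → ℂ} (hr : LocallyIntegrable r)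
    (h : ∀ t, g t - g 0 = ∫ u in (0 : ℝ)..t, r u) :
    LocallyAC g ∧ ∀ᵐ t, HasDerivAt g (r t) t := by
  have hg : g = fun t => (∫ u in (0 : ℝ)..t, r u) + g 0 := by
    ext t; rw [← h]; ring
  constructor
  · rw [hg]
    intro a b
    exact (locallyAC_integral hr a b).add
      (contDiffOn_const.absolutelyContinuousOnInterval (f := fun _ => g 0))
  · filter_upwards [LocallyIntegrable.ae_hasDerivAt_integral hr] with t ht
    rw [hg]
    exact (ht 0).add_const _

/-- Used to get integrability: if $P$ and $Q=2\pi i\xi P$ are in $L^2$, then $P=(1-2\pi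
i\xi)^{-1}(P-Q)$ is a product of two $L^2$ functions. -/
theorem memLp_inv_one_sub : MemLp (fun ξ : ℝ => (1 - 2 * Real.pi * Complex.I * ξ)⁻¹) 2 := by
  have hc : Continuous fun ξ : ℝ => (1 - 2 * Real.pi * Complex.I * ξ) := by fun_prop
  have hne : ∀ ξ : ℝ, (1 - 2 * Real.pi * Complex.I * ξ) ≠ 0 := by
    intro ξ h
    have := congrArg Complex.re h
    simp at this
  have hc' : Continuous fun ξ : ℝ => (1 - 2 * Real.pi * Complex.I * ξ)⁻¹ := hc.inv₀ hne
  rw [memLp_two_iff_integrable_sq_norm hc'.aestronglyMeasurable]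
  refine Integrable.mono' integrable_inv_one_add_sq (hc'.norm.pow 2).aestronglyMeasurable
    (ae_of_all _ fun ξ => ?_)
  have h1 : ‖(1 - 2 * Real.pi * Complex.I * ξ)‖ ^ 2 = 1 + 4 * Real.pi ^ 2 * ξ ^ 2 := by
    rw [Complex.sq_norm, Complex.normSq_apply]
    simp
    ring
  rw [norm_inv, inv_pow, h1, Real.norm_of_nonneg (by positivity)]
  apply inv_anti₀ (by positivity)
  have := Real.pi_gt_three
  nlinarith [mul_nonneg (sq_nonneg ξ) (by nlinarith : (0 : ℝ) ≤ 4 * Real.pi ^ 2 - 1)]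

theorem fourier_indicator_Ioc {a b ξ : ℝ} (hab : a ≤ b) (hξ : ξ ≠ 0) :
    starRingEnd ℂ (𝓕 ((Set.Ioc a b).indicator fun _ => (1 : ℂ)) ξ) * (2 * Real.pi * Complex.I * ξ) =
      Complex.exp (2 * Real.pi * Complex.I * ξ * b) -
        Complex.exp (2 * Real.pi * Complex.I * ξ * a) := by
  have hne : -(2 * Real.pi * Complex.I * ξ) ≠ 0 := by
    simp [Real.pi_ne_zero, hξ]
  have h1 : 𝓕 ((Set.Ioc a b).indicator fun _ => (1 : ℂ)) ξ =
      ∫ t in a..b, Complex.exp (-(2 * Real.pi * Complex.I * ξ) * t) := by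
    rw [Real.fourier_eq', intervalIntegral.integral_of_le hab, ← integral_indicator
      measurableSet_Ioc]
    refine integral_congr_ae (ae_of_all _ fun t => ?_)
    by_cases ht : t ∈ Set.Ioc a b
    · simp only [ht, Set.indicator_of_mem, smul_eq_mul, mul_one]
      congr 1
      simp
      ring
    · simp [ht]
  rw [h1, integral_exp_mul_complex hne, map_div₀, map_sub, ← Complex.exp_conj, ← Complex.exp_conj]
  simp only [map_mul, map_neg, Complex.conj_I, Complex.conj_ofReal, map_ofNat, mul_neg, neg_mul,
    neg_neg]
  have hne' : (2 * Real.pi * Complex.I * ξ : ℂ) ≠ 0 := neg_ne_zero.1 hne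
  exact div_mul_cancel₀ _ hne'

/-- If `P` and `2πiξ P` are in `L²`, then the inverse Fourier transform of `P` is locally absolutely
continuous, and its derivative is the inverse Fourier transform of `2πiξ P`. -/
theorem exists_locallyAC_fourierInv {P Q : Lp ℂ 2 (volume : Measure ℝ)}
    (hPQ : Q =ᵐ[volume] fun ξ => 2 * Real.pi * Complex.I * ξ * P ξ) :
    ∃ g : ℝ → ℂ, LocallyAC g ∧
      ((𝓕⁻ P : Lp ℂ 2 (volume : Measure ℝ)) : ℝ → ℂ) =ᵐ[volume] g ∧
      ∀ᵐ t, HasDerivAt g ((𝓕⁻ Q : Lp ℂ 2 (volume : Measure ℝ)) t) t := by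
  have hP2 : MemLp P 2 := Lp.memLp P
  have hP1 : Integrable P := by
    refine (memLp_inv_one_sub.integrable_mul ((Lp.memLp P).sub (Lp.memLp Q))).congr ?_
    filter_upwards [hPQ] with ξ h
    have hne : (1 - 2 * Real.pi * Complex.I * ξ) ≠ 0 := by
      intro h
      have := congrArg Complex.re h
      simp at this
    simp only [Pi.mul_apply, Pi.sub_apply, h]
    field_simp
  have hF := fourierInv_toLp_ae_eq hP1 hP2
  rw [Lp.toLp_coeFn] at hF
  have hr : LocallyIntegrable (𝓕⁻ Q : Lp ℂ 2 (volume : Measure ℝ)) :=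
    (Lp.memLp _).locallyIntegrable (by norm_num)
  have hexp : ∀ t : ℝ, Integrable fun v : ℝ =>
      Complex.exp (((2 * Real.pi * (inner ℝ v t) : ℝ) : ℂ) * Complex.I) • P v := by
    intro t
    have hc : Continuous fun v : ℝ =>
        Complex.exp (((2 * Real.pi * (inner ℝ v t) : ℝ) : ℂ) * Complex.I) := by fun_prop
    refine hP1.mono (hc.aestronglyMeasurable.smul hP1.1) (ae_of_all _ fun v => ?_)
    rw [norm_smul, Complex.norm_exp_ofReal_mul_I, one_mul]
  -- The integral of $\mathcal F^{-1}Q$ over $(a,b]$ is an inner product with an indicator.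
  -- Plancherel moves it to the frequency side, where the factor $2\pi i\xi$ in $Q$ cancels the
  -- denominator of the transformed indicator and leaves $e^{2\pi i\xi b}-e^{2\pi i\xi a}$ against
  -- $P$.
  have key : ∀ a b : ℝ, a ≤ b → 𝓕⁻ (P : ℝ → ℂ) b - 𝓕⁻ (P : ℝ → ℂ) a =
      ∫ t in a..b, (𝓕⁻ Q : Lp ℂ 2 (volume : Measure ℝ)) t := by
    intro a b hab
    have hfin : volume (Set.Ioc a b) ≠ (⊤ : ℝ≥0∞) := by simp
    rw [intervalIntegral.integral_of_le hab, ← L2.inner_indicatorConstLp_one (𝕜 := ℂ)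
      measurableSet_Ioc hfin, ← Lp.inner_fourier_eq, fourier_fourierInv_eq, L2.inner_def,
      Real.fourierInv_eq', Real.fourierInv_eq', ← integral_sub]
    · refine integral_congr_ae ?_
      have hI1 : Integrable ((Set.Ioc a b).indicator fun _ => (1 : ℂ)) :=
        (integrable_indicator_iff measurableSet_Ioc).2 (by simp)
      have hI := fourier_toLp_ae_eq hI1 (memLp_indicator_const 2 measurableSet_Ioc 1 (Or.inr hfin))
      filter_upwards [hPQ, hI, Measure.ae_ne volume (0 : ℝ)] with ξ h1 h2 h3
      rw [indicatorConstLp, h2, h1]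
      have h4 := fourier_indicator_Ioc hab h3
      have e : ∀ t : ℝ, Complex.exp (((2 * Real.pi * (inner ℝ ξ t) : ℝ) : ℂ) * Complex.I) =
          Complex.exp (2 * Real.pi * Complex.I * ξ * t) := by
        intro t
        congr 1
        simp
        ring
      rw [e, e, ← sub_smul, ← h4, smul_eq_mul, RCLike.inner_apply]
      ring
    · exact hexp b
    · exact hexp a
  have key' : ∀ t : ℝ, 𝓕⁻ (P : ℝ → ℂ) t - 𝓕⁻ (P : ℝ → ℂ) 0 =
      ∫ u in (0 : ℝ)..t, (𝓕⁻ Q : Lp ℂ 2 (volume : Measure ℝ)) u := by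
    intro t
    rcases le_total 0 t with h | h
    · exact key 0 t h
    · rw [intervalIntegral.integral_symm, ← key t 0 h]
      ring
  obtain ⟨h1, h2⟩ := locallyAC_of_sub_eq_integral hr key'
  exact ⟨_, h1, hF, h2⟩

end Fourier

/-! ### Diagonalization of $\partial_c$. -/

section Shift

open FourierTransform

theorem volume_ac_weightMeasure (c : ℝ) : volume ≪ weightMeasure c :=
  withDensity_absolutelyContinuous' (by fun_prop) (ae_of_all _ fun t => by simp [Real.exp_pos])

theorem ae_weightMeasure_iff (c : ℝ) {p : ℝ → Prop} :
    (∀ᵐ t ∂(weightMeasure c), p t) ↔ ∀ᵐ t, p t :=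
  ⟨fun h => (volume_ac_weightMeasure c).ae_le h, fun h => (weightMeasure_ac c).ae_le h⟩

theorem lintegral_weightMeasure (c : ℝ) (f : ℝ → ℂ) (hf : AEStronglyMeasurable f) :
    ∫⁻ t, ‖f t‖ₑ ^ 2 ∂(weightMeasure c) = ∫⁻ t : ℝ, ‖Complex.exp (-c * t) * f t‖ₑ ^ 2 := by
  rw [weightMeasure, lintegral_withDensity_eq_lintegral_mul₀ (by fun_prop)
    (hf.enorm.pow_const 2)]
  refine lintegral_congr fun t => ?_
  rw [Pi.mul_apply, enorm_mul, mul_pow]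
  congr 1
  rw [← ofReal_norm, ← ENNReal.ofReal_pow (norm_nonneg _), Complex.norm_exp, ← Real.exp_nat_mul]
  congr 2
  simp
  ring

theorem memLp_exp_mul_of_weighted (c : ℝ) {f : ℝ → ℂ} (hf : MemLp f 2 (weightMeasure c)) :
    MemLp (fun t : ℝ => Complex.exp (-c * t) * f t) 2 := by
  have h1 : AEStronglyMeasurable f := hf.1.mono_ac (volume_ac_weightMeasure c)
  have hc : Continuous fun t : ℝ => Complex.exp (-c * t) := by fun_prop
  refine memLp_two_of_lintegral (hc.aestronglyMeasurable.mul h1) ?_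
  rw [← lintegral_weightMeasure c f h1, ← eLpNorm_two_sq]
  exact ENNReal.pow_lt_top hf.2

theorem memLp_weighted_exp_mul (c : ℝ) {f : ℝ → ℂ} (hf : MemLp f 2) :
    MemLp (fun t : ℝ => Complex.exp (c * t) * f t) 2 (weightMeasure c) := by
  have hc : Continuous fun t : ℝ => Complex.exp (c * t) := by fun_prop
  have h1 := hc.aestronglyMeasurable.mul hf.1
  refine memLp_two_of_lintegral (h1.mono_ac (weightMeasure_ac c)) ?_
  have h2 := lintegral_weightMeasure c _ h1
  simp only [← mul_assoc, ← Complex.exp_add, Pi.mul_apply] at h2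
  simp only [neg_mul, neg_add_cancel, Complex.exp_zero, one_mul] at h2
  rw [h2, ← eLpNorm_two_sq]
  exact ENNReal.pow_lt_top hf.2

/-- Multiplication by `e^{-ct}` as a unitary map from `L²(ℝ, e^{-2ct} dt)` to `L²(ℝ)`. -/
def unweight (c : ℝ) : WeightedL2 c ≃ₗᵢ[ℂ] Lp ℂ 2 (volume : Measure ℝ) where
  toFun f := (memLp_exp_mul_of_weighted c (Lp.memLp f)).toLp
  invFun g := (memLp_weighted_exp_mul c (Lp.memLp g)).toLp
  map_add' f g := by
    apply Lp.ext
    filter_upwards [(memLp_exp_mul_of_weighted c (Lp.memLp (f + g))).coeFn_toLp,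
      (memLp_exp_mul_of_weighted c (Lp.memLp f)).coeFn_toLp,
      (memLp_exp_mul_of_weighted c (Lp.memLp g)).coeFn_toLp,
      (ae_weightMeasure_iff c).1 (Lp.coeFn_add f g),
      Lp.coeFn_add (memLp_exp_mul_of_weighted c (Lp.memLp f)).toLp
        (memLp_exp_mul_of_weighted c (Lp.memLp g)).toLp] with t h1 h2 h3 h4 h5
    rw [h1, h5, Pi.add_apply, h2, h3, h4, Pi.add_apply, mul_add]
  map_smul' a f := by
    apply Lp.ext
    filter_upwards [(memLp_exp_mul_of_weighted c (Lp.memLp (a • f))).coeFn_toLp,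
      (memLp_exp_mul_of_weighted c (Lp.memLp f)).coeFn_toLp,
      (ae_weightMeasure_iff c).1 (Lp.coeFn_smul a f),
      Lp.coeFn_smul a (memLp_exp_mul_of_weighted c (Lp.memLp f)).toLp] with t h1 h2 h3 h4
    rw [h1, RingHom.id_apply, h4, Pi.smul_apply, h2, h3, Pi.smul_apply, mul_smul_comm]
  left_inv f := by
    apply Lp.ext
    rw [EventuallyEq, ae_weightMeasure_iff]
    have h0 := memLp_exp_mul_of_weighted c (Lp.memLp f)
    filter_upwards [h0.coeFn_toLp,
      (ae_weightMeasure_iff c).1 (memLp_weighted_exp_mul c (Lp.memLp h0.toLp)).coeFn_toLp]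
      with t h1 h2
    rw [h2, h1, ← mul_assoc, ← Complex.exp_add]
    simp
  right_inv g := by
    apply Lp.ext
    have h0 := memLp_weighted_exp_mul c (Lp.memLp g)
    filter_upwards [(ae_weightMeasure_iff c).1 h0.coeFn_toLp,
      (memLp_exp_mul_of_weighted c (Lp.memLp h0.toLp)).coeFn_toLp] with t h1 h2
    rw [h2, h1, ← mul_assoc, ← Complex.exp_add]
    simp
  norm_map' f := by
    have h0 := memLp_exp_mul_of_weighted c (Lp.memLp f)
    have h1 : ‖h0.toLp‖ₑ ^ 2 = ‖f‖ₑ ^ 2 := by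
      rw [enorm_sq_eq_lintegral, enorm_sq_eq_lintegral, lintegral_weightMeasure c f
        ((Lp.aestronglyMeasurable f).mono_ac (volume_ac_weightMeasure c))]
      refine lintegral_congr_ae ?_
      filter_upwards [h0.coeFn_toLp] with t h1
      rw [h1]
    have h2 : ‖h0.toLp‖ₑ = ‖f‖ₑ := le_antisymm
      ((ENNReal.pow_le_pow_left_iff two_ne_zero).1 h1.le)
      ((ENNReal.pow_le_pow_left_iff two_ne_zero).1 h1.ge)
    exact (enorm_eq_iff_norm_eq).1 h2

theorem coeFn_unweight (c : ℝ) (f : WeightedL2 c) :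
    unweight c f =ᵐ[volume] fun t => Complex.exp (-c * t) * f t :=
  (memLp_exp_mul_of_weighted c (Lp.memLp f)).coeFn_toLp

/-- The Fourier transform of `e^{-ct} f(t)`. -/
def spectralTransform (c : ℝ) : WeightedL2 c ≃ₗᵢ[ℂ] Lp ℂ 2 (volume : Measure ℝ) :=
  (unweight c).trans (Lp.fourierTransformₗᵢ ℝ ℂ)

theorem spectralTransform_apply (c : ℝ) (f : WeightedL2 c) :
    spectralTransform c f = 𝓕 (unweight c f) := rfl

/-- The parametrization `ξ ↦ c + 2πiξ` of the line `Re z = c`. -/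
def lineParam (c : ℝ) (ξ : ℝ) : ℂ := c + 2 * Real.pi * Complex.I * ξ

theorem continuous_lineParam (c : ℝ) : Continuous (lineParam c) := by
  unfold lineParam; fun_prop

/-- The resolution of the identity of `∂_c`. -/
def shiftResolution (c : ℝ) : ResolutionOfIdentity (WeightedL2 c) :=
  multiplicationResolution (spectralTransform c) (continuous_lineParam c).measurable

theorem mem_integralGraph_shiftResolution_iff {c : ℝ} {x y : WeightedL2 c} :
    (x, y) ∈ (shiftResolution c).integralGraph id ↔
      spectralTransform c y =ᵐ[volume] fun ξ => lineParam c ξ * spectralTransform c x ξ :=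
  mem_integralGraph_multiplicationResolution_iff _ _ measurable_id

theorem locallyAC_exp (a : ℂ) : LocallyAC fun t : ℝ => Complex.exp (a * t) := by
  intro p q
  refine ContDiffOn.absolutelyContinuousOnInterval (ContDiff.contDiffOn ?_)
  exact Complex.contDiff_exp.comp (contDiff_const.mul Complex.ofRealCLM.contDiff)

theorem LocallyAC.exp_mul {g : ℝ → ℂ} (hg : LocallyAC g) (a : ℂ) :
    LocallyAC fun t : ℝ => Complex.exp (a * t) * g t := fun p q =>
  (locallyAC_exp a p q).smul (hg p q)

theorem hasDerivAt_exp_mul {g : ℝ → ℂ} {a g' : ℂ} {t : ℝ} (h : HasDerivAt g g' t) :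
    HasDerivAt (fun t : ℝ => Complex.exp (a * t) * g t)
      (Complex.exp (a * t) * (a * g t + g')) t := by
  have h1 : HasDerivAt (fun t : ℝ => Complex.exp (a * t)) (Complex.exp (a * t) * a) t := by
    have := (Complex.ofRealCLM.hasDerivAt (x := t)).const_mul a
    simpa using! this.cexp
  have h2 : Complex.exp (a * t) * a * g t + Complex.exp (a * t) * g' =
      Complex.exp (a * t) * (a * g t + g') := by ring
  exact h2 ▸ h1.mul h

/-- Subtracting $c$ leaves the multiplier $2\pi i\xi$, so $e^{-ct}x$ has derivative $e^{-ct}(y-cx)$;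
the product rule with $e^{ct}$ then gives $x'=y$. -/
theorem mem_shiftGraph_of_mem_integralGraph {c : ℝ} {x y : WeightedL2 c}
    (h : (x, y) ∈ (shiftResolution c).integralGraph id) : (x, y) ∈ shiftGraph c := by
  rw [mem_integralGraph_shiftResolution_iff] at h
  set P := spectralTransform c x with hP
  set Q := spectralTransform c y - (c : ℂ) • P with hQ
  have hPQ : Q =ᵐ[volume] fun ξ => 2 * Real.pi * Complex.I * ξ * P ξ := by
    filter_upwards [h, Lp.coeFn_sub (spectralTransform c y) ((c : ℂ) • P),
      Lp.coeFn_smul (c : ℂ) P] with ξ h1 h2 h3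
    rw [hQ, h2, Pi.sub_apply, h1, h3, Pi.smul_apply, smul_eq_mul, lineParam]
    ring
  obtain ⟨g, hg, hPg, hQg⟩ := exists_locallyAC_fourierInv hPQ
  have hPx : (𝓕⁻ P : Lp ℂ 2 (volume : Measure ℝ)) = unweight c x := by
    rw [hP, spectralTransform_apply, fourierInv_fourier_eq]
  have hQx : (𝓕⁻ Q : Lp ℂ 2 (volume : Measure ℝ)) = unweight c y - (c : ℂ) • unweight c x := by
    have : Q = 𝓕 (unweight c y - (c : ℂ) • unweight c x) := by
      rw [hQ, hP, ← map_smul, ← map_sub, spectralTransform_apply, map_sub, map_smul]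
    rw [this, fourierInv_fourier_eq]
  rw [hPx] at hPg
  rw [hQx] at hQg
  have hx : ∀ᵐ t : ℝ, x t = Complex.exp (c * t) * g t := by
    filter_upwards [hPg, coeFn_unweight c x] with t h1 h2
    rw [← h1, h2, ← mul_assoc, ← Complex.exp_add]
    simp
  refine ⟨fun t => Complex.exp (c * t) * g t, hg.exp_mul c, (ae_weightMeasure_iff c).2 hx,
    (ae_weightMeasure_iff c).2 ?_⟩
  filter_upwards [hPg, hQg, coeFn_unweight c x, coeFn_unweight c y,
    Lp.coeFn_sub (unweight c y) ((c : ℂ) • unweight c x),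
    Lp.coeFn_smul (c : ℂ) (unweight c x)] with t h1 h2 h3 h4 h5 h6
  rw [(hasDerivAt_exp_mul h2).deriv, h5, Pi.sub_apply, h6, Pi.smul_apply, smul_eq_mul, h1,
    add_sub_cancel, h4, ← mul_assoc, ← Complex.exp_add]
  simp

/-- A solution of $g'=(c+1)g$ is $g(0)e^{(c+1)t}$; after unweighting it is $g(0)e^t$, not square
integrable at $+\infty$ unless $g(0)=0$. -/
theorem eq_zero_of_mem_shiftGraph {c : ℝ} {x : WeightedL2 c}
    (h : (x, ((c + 1 : ℝ) : ℂ) • x) ∈ shiftGraph c) : x = 0 := by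
  obtain ⟨g, hg, hx, hx'⟩ := h
  dsimp only at hx hx'
  have hd : ∀ᵐ t : ℝ, HasDerivAt g ((c + 1 : ℝ) * g t) t := by
    filter_upwards [(ae_weightMeasure_iff c).1 hx, (ae_weightMeasure_iff c).1 hx',
      (ae_weightMeasure_iff c).1 (hg.ae_differentiableAt c),
      (ae_weightMeasure_iff c).1 (Lp.coeFn_smul ((c + 1 : ℝ) : ℂ) x)] with t h1 h2 h3 h4
    have h5 := h3.hasDerivAt
    rw [← h2, h4, Pi.smul_apply, h1] at h5
    exact h5
  -- An absolutely continuous function with derivative zero almost everywhere is constant; this is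
  -- where local absolute continuity is indispensable.
  have hconst : ∀ t : ℝ, Complex.exp (-(c + 1 : ℝ) * t) * g t = g 0 := by
    intro t
    obtain ⟨C, hC⟩ := (hg.exp_mul (-(c + 1 : ℝ)) 0 t).const_of_ae_hasDerivAt_zero (by
      filter_upwards [hd] with u hu _
      have := hasDerivAt_exp_mul (a := -(c + 1 : ℝ)) hu
      rwa [neg_mul ((c + 1 : ℝ) : ℂ) (g u), neg_add_cancel, mul_zero] at this)
    rw [hC t Set.right_mem_uIcc, ← hC 0 Set.left_mem_uIcc]
    simp
  have hg' : ∀ t : ℝ, g t = Complex.exp ((c + 1 : ℝ) * t) * g 0 := by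
    intro t
    rw [← hconst t, ← mul_assoc, ← Complex.exp_add, neg_mul, add_neg_cancel, Complex.exp_zero,
      one_mul]
  have hu : unweight c x =ᵐ[volume] fun t : ℝ => Complex.exp t * g 0 := by
    filter_upwards [coeFn_unweight c x, (ae_weightMeasure_iff c).1 hx] with t h1 h2
    rw [h1, h2, hg', ← mul_assoc, ← Complex.exp_add]
    congr 2
    push_cast
    ring
  have hg0 : g 0 = 0 := by
    have h1 := (memLp_two_iff_integrable_sq_norm (Lp.aestronglyMeasurable _)).1
      (Lp.memLp (unweight c x))
    have h2 : IntegrableOn (fun _ : ℝ => ‖g 0‖ ^ 2) (Set.Ioi 0) := by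
      refine Integrable.mono' h1.integrableOn aestronglyMeasurable_const ?_
      filter_upwards [ae_restrict_of_ae hu, ae_restrict_mem measurableSet_Ioi] with t h3 h4
      rw [h3, norm_mul, mul_pow, Real.norm_of_nonneg (by positivity), Complex.norm_exp,
        Complex.ofReal_re]
      have : 1 ≤ Real.exp t := Real.one_le_exp (le_of_lt h4)
      nlinarith [sq_nonneg ‖g 0‖, one_le_pow₀ this (n := 2)]
    rw [integrableOn_const_iff] at h2
    simpa using h2
  apply Lp.ext
  rw [EventuallyEq, ae_weightMeasure_iff]
  filter_upwards [(ae_weightMeasure_iff c).1 hx,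
    (ae_weightMeasure_iff c).1 (Lp.coeFn_zero ℂ 2 (weightMeasure c))] with t h1 h2
  rw [h1, h2, hg', hg0]
  simp

/-- Given $(x,y)$ in the differentiation graph, solve $(A-(c+1))x'=y-(c+1)x$ for the multiplication
operator $A$. Then $x-x'$ is an eigenvector of $\partial_c$ for $c+1$ or zero, and
`eq_zero_of_mem_shiftGraph` gives $x=x'$. -/
theorem integralGraph_shiftResolution (c : ℝ) :
    (shiftResolution c).integralGraph id = shiftGraph c := by
  refine le_antisymm (fun p hp => mem_shiftGraph_of_mem_integralGraph hp) ?_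
  rintro ⟨x, y⟩ hxy
  set u := y - ((c + 1 : ℝ) : ℂ) • x with hu
  set V := spectralTransform c u with hV
  have hne : ∀ ξ : ℝ, (2 * Real.pi * Complex.I * ξ - 1) ≠ 0 := by
    intro ξ h
    have := congrArg Complex.re h
    simp at this
  have hc : Continuous fun ξ : ℝ => (2 * Real.pi * Complex.I * ξ - 1)⁻¹ :=
    (by fun_prop : Continuous fun ξ : ℝ => (2 * Real.pi * Complex.I * ξ - 1)).inv₀ hne
  -- The multiplier of $A-(c+1)$ is $2\pi i\xi-1$, whose real part $-1$ bounds its modulus below by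
  -- $1$.
  have hL : MemLp (fun ξ : ℝ => (2 * Real.pi * Complex.I * ξ - 1)⁻¹ * V ξ) 2 := by
    refine (Lp.memLp V).mono (hc.aestronglyMeasurable.mul (Lp.aestronglyMeasurable V))
      (ae_of_all _ fun ξ => ?_)
    rw [norm_mul, norm_inv]
    have h1 : 1 ≤ ‖(2 * Real.pi * Complex.I * ξ - 1)‖ := by
      have := Complex.abs_re_le_norm (2 * Real.pi * Complex.I * ξ - 1)
      simpa using this
    exact mul_le_of_le_one_left (norm_nonneg _) (inv_le_one_of_one_le₀ h1)
  set x' := (spectralTransform c).symm hL.toLp with hx'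
  set y' := u + ((c + 1 : ℝ) : ℂ) • x' with hy'
  have hmem : (x', y') ∈ (shiftResolution c).integralGraph id := by
    rw [mem_integralGraph_shiftResolution_iff, hy', map_add, map_smul, ← hV]
    have e : spectralTransform c x' = hL.toLp := by rw [hx']; simp
    rw [e]
    filter_upwards [hL.coeFn_toLp, Lp.coeFn_add V (((c + 1 : ℝ) : ℂ) • hL.toLp),
      Lp.coeFn_smul ((c + 1 : ℝ) : ℂ) hL.toLp] with ξ h1 h2 h3
    rw [h2, Pi.add_apply, h3, Pi.smul_apply, h1, smul_eq_mul, lineParam]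
    have := hne ξ
    push_cast
    field_simp
    ring
  have hsub := (shiftGraph c).sub_mem hxy (mem_shiftGraph_of_mem_integralGraph hmem)
  have hyy : y - y' = ((c + 1 : ℝ) : ℂ) • (x - x') := by
    rw [hy', hu, smul_sub]
    abel
  rw [Prod.mk_sub_mk, hyy] at hsub
  have h0 := eq_zero_of_mem_shiftGraph hsub
  rw [h0, smul_zero] at hyy
  rw [sub_eq_zero.1 h0, sub_eq_zero.1 hyy]
  exact hmem

theorem isResolutionOf_shiftResolution (c : ℝ) :
    IsResolutionOf (shiftResolution c) (infinitesimalShift c) := by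
  rw [IsResolutionOf, ResolutionOfIdentity.integral, integralGraph_shiftResolution,
    infinitesimalShift]

end Shift

/-! ### The spectra of $\partial_c$ and $\zeta(\partial_c)$. -/

section Spectrum

theorem lineParam_re (c ξ : ℝ) : (lineParam c ξ).re = c := by
  simp [lineParam]

theorem exists_lineParam_eq {c : ℝ} {z : ℂ} (hz : z.re = c) : ∃ ξ, lineParam c ξ = z := by
  refine ⟨z.im / (2 * Real.pi), ?_⟩
  have := Real.pi_ne_zero
  apply Complex.ext
  · rw [lineParam_re, hz]
  · have h : lineParam c (z.im / (2 * Real.pi)) = c + (z.im : ℂ) * Complex.I := by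
      rw [lineParam]
      push_cast
      field_simp
    rw [h]
    simp

theorem shiftResolution_proj_ball_ne_zero {c : ℝ} {z : ℂ} (hz : z.re = c) {ε : ℝ} (hε : 0 < ε) :
    (shiftResolution c).proj (Metric.ball z ε) ≠ 0 := by
  intro h
  obtain ⟨ξ, rfl⟩ := exists_lineParam_eq hz
  have hm : MeasurableSet (Metric.ball (lineParam c ξ) ε) := Metric.isOpen_ball.measurableSet
  set S := lineParam c ⁻¹' Metric.ball (lineParam c ξ) ε with hS
  have hSo : IsOpen S := Metric.isOpen_ball.preimage (continuous_lineParam c)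
  -- Cutting with a bounded ball makes the volume finite, so that the indicator of $T$ is an $L^2$
  -- function fixed by the projection.
  set T := S ∩ Metric.ball ξ 1 with hT
  have hTo : IsOpen T := hSo.inter Metric.isOpen_ball
  have hTne : T.Nonempty := ⟨ξ, Metric.mem_ball_self hε, Metric.mem_ball_self one_pos⟩
  have hTfin : volume T ≠ ∞ :=
    ne_top_of_le_ne_top measure_ball_lt_top.ne (measure_mono Set.inter_subset_right)
  set k : Lp ℂ 2 (volume : Measure ℝ) := indicatorConstLp 2 hTo.measurableSet hTfin 1 with hk
  have h1 := multiplicationResolution_proj (spectralTransform c)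
    (continuous_lineParam c).measurable hm ((spectralTransform c).symm k)
  rw [← shiftResolution, h, LinearIsometryEquiv.apply_symm_apply, zero_apply, map_zero] at h1
  have h2 : ∀ᵐ t : ℝ, t ∉ T := by
    filter_upwards [coeFn_mulIndicator hSo.measurableSet k,
      indicatorConstLp_coeFn (p := 2) (hs := hTo.measurableSet) (hμs := hTfin) (c := (1 : ℂ)),
      Lp.coeFn_zero ℂ 2 (volume : Measure ℝ)] with t h2 h3 h4 ht
    have h5 : mulIndicator hSo.measurableSet k t = 0 := by rw [← h1, h4]; rfl
    rw [h2, Set.indicator_of_mem ht.1, hk, h3, Set.indicator_of_mem ht] at h5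
    exact one_ne_zero h5
  exact hTo.measure_ne_zero volume hTne (measure_eq_zero_iff_ae_notMem.2 h2)

theorem shiftResolution_proj_eq_zero {c : ℝ} {B : Set ℂ} (hB : MeasurableSet B)
    (h : ∀ z ∈ B, z.re ≠ c) : (shiftResolution c).proj B = 0 := by
  ext1 x
  apply (spectralTransform c).injective
  rw [zero_apply, map_zero, shiftResolution, multiplicationResolution_proj _ _ hB]
  apply Lp.ext
  filter_upwards [coeFn_mulIndicator ((continuous_lineParam c).measurable hB)
    (spectralTransform c x), Lp.coeFn_zero ℂ 2 (volume : Measure ℝ)] with t h1 h2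
  rw [h1, h2, Set.indicator_of_notMem (s := lineParam c ⁻¹' B) fun ht => h _ ht (lineParam_re c t)]
  rfl

theorem exists_ball_re_ne {c : ℝ} {z : ℂ} (hz : z.re ≠ c) :
    ∃ ε > 0, ∀ w ∈ Metric.ball z ε, w.re ≠ c :=
  Metric.isOpen_iff.1 (isOpen_ne_fun Complex.continuous_re continuous_const) z hz

/-- The spectrum of `∂_c` is the line `Re z = c`. -/
theorem opSpectrum_infinitesimalShift (c : ℝ) :
    opSpectrum (infinitesimalShift c) = {s : ℂ | s.re = c} := by
  rw [← isResolutionOf_shiftResolution c, ResolutionOfIdentity.opSpectrum_integral _ measurable_id]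
  ext z
  refine ⟨fun h => ?_, fun h ε hε => shiftResolution_proj_ball_ne_zero h hε⟩
  by_contra hz
  obtain ⟨ε, hε, hw⟩ := exists_ball_re_ne hz
  exact h ε hε (shiftResolution_proj_eq_zero Metric.isOpen_ball.measurableSet hw)

/-- `∂_c` has no eigenvectors. -/
theorem eq_zero_of_eigenvector {c : ℝ} {x : WeightedL2 c} {z : ℂ}
    (h : (x, z • x) ∈ (infinitesimalShift c).graph) : x = 0 := by
  rw [← isResolutionOf_shiftResolution c, ResolutionOfIdentity.mem_graph_integral_iff _
    measurable_id, mem_integralGraph_shiftResolution_iff, map_smul] at h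
  apply (spectralTransform c).injective
  rw [map_zero]
  apply Lp.ext
  filter_upwards [h, Lp.coeFn_smul z (spectralTransform c x),
    Lp.coeFn_zero ℂ 2 (volume : Measure ℝ),
    -- The only frequency at which $c+2\pi i\xi=z$ can hold; taking the real part gives a real
    -- number even when $z$ is off the line.
    Measure.ae_ne volume ((z - c) / (2 * Real.pi * Complex.I)).re] with ξ h1 h2 h3 h4
  rw [h3, Pi.zero_apply]
  rw [h2, Pi.smul_apply, smul_eq_mul] at h1
  by_contra hne
  apply h4
  have h5 := mul_right_cancel₀ hne h1
  have h6 : (2 * Real.pi * Complex.I : ℂ) ≠ 0 := by simp [Real.pi_ne_zero]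
  rw [h5, lineParam, add_sub_cancel_left, mul_div_cancel_left₀ _ h6, Complex.ofReal_re]

variable {c : ℝ} {E : ResolutionOfIdentity (WeightedL2 c)}

/-- Here $E$ is any resolution of $\partial_c$. The spectrum depends on the operator alone, so its
value found with the explicit resolution yields information on $E$. -/
theorem proj_ball_ne_zero_of_isResolutionOf (hE : IsResolutionOf E (infinitesimalShift c)) {z : ℂ}
    (hz : z.re = c) {ε : ℝ} (hε : 0 < ε) : E.proj (Metric.ball z ε) ≠ 0 := by
  have h : z ∈ opSpectrum (infinitesimalShift c) := by
    rw [opSpectrum_infinitesimalShift]; exact hz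
  rw [← hE, ResolutionOfIdentity.opSpectrum_integral _ measurable_id] at h
  exact h ε hε

/-- Each point off the line is outside the spectrum and so has an $E$-null ball around it; locally
null sets are null for each $\langle Ex,x\rangle$. -/
theorem proj_compl_line_of_isResolutionOf (hE : IsResolutionOf E (infinitesimalShift c)) :
    E.proj {z : ℂ | z.re ≠ c} = 0 := by
  have ho : IsOpen {z : ℂ | z.re ≠ c} := isOpen_ne_fun Complex.continuous_re continuous_const
  refine E.proj_eq_zero_of_measure_eq_zero ho.measurableSet fun x => ?_
  refine measure_null_of_locally_null _ fun z hz => ?_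
  have h : z ∉ opSpectrum (infinitesimalShift c) := by
    rw [opSpectrum_infinitesimalShift]; exact hz
  rw [← hE, ResolutionOfIdentity.opSpectrum_integral _ measurable_id] at h
  simp only [Set.mem_ofPred_eq, not_forall, not_not] at h
  obtain ⟨ε, hε, h0⟩ := h
  exact ⟨Metric.ball z ε, mem_nhdsWithin_of_mem_nhds (Metric.ball_mem_nhds z hε),
    E.measure_eq_zero_of_proj_eq_zero Metric.isOpen_ball.measurableSet h0 x⟩

/-- On the range of $E(\{z\})$ the function $w\mapsto w$ equals $z$ almost everywhere, so a nonzero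
vector there would be an eigenvector of $\partial_c$. -/
theorem proj_singleton_of_isResolutionOf (hE : IsResolutionOf E (infinitesimalShift c)) (z : ℂ) :
    E.proj {z} = 0 := by
  ext1 u
  have hm : MeasurableSet ({z} : Set ℂ) := measurableSet_singleton z
  have hx : E.proj {z} (E.proj {z} u) = E.proj {z} u := by
    rw [E.proj_proj hm hm, Set.inter_self]
  refine eq_zero_of_eigenvector (z := z) ?_
  rw [← hE, ResolutionOfIdentity.mem_graph_integral_iff _ measurable_id]
  refine ResolutionOfIdentity.mem_integralGraph_congr_ae measurable_const measurable_id
    (E.const_mem_integralGraph z _) ?_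
  filter_upwards [E.ae_mem_of_proj_eq_self hm hx] with w hw
  exact (Set.mem_singleton_iff.1 hw).symm

theorem measurable_riemannZeta : Measurable riemannZeta :=
  measurable_of_continuousOn_compl_singleton 1 fun _ hs =>
    (differentiableAt_riemannZeta hs).continuousAt.continuousWithinAt

theorem opSpectrum_integral_riemannZeta (hE : IsResolutionOf E (infinitesimalShift c)) :
    opSpectrum (E.integral riemannZeta) = closure (riemannZeta '' ({s : ℂ | s.re = c} \ {1})) := by
  rw [ResolutionOfIdentity.opSpectrum_integral _ measurable_riemannZeta]
  ext a
  rw [Set.mem_ofPred_eq, Metric.mem_closure_iff]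
  refine forall₂_congr fun ε hε => ?_
  have hm : MeasurableSet (riemannZeta ⁻¹' Metric.ball a ε) :=
    measurable_riemannZeta Metric.isOpen_ball.measurableSet
  constructor
  · intro h
    by_contra! hcon
    apply h
    -- If no value of $\zeta$ on the punctured line is within $\varepsilon$ of $a$, the preimage of
    -- the ball lies in this null set, whatever value `riemannZeta` takes at $1$.
    have h1 : E.proj ({z : ℂ | z.re ≠ c} ∪ {1}) = 0 := by
      refine E.proj_eq_zero_of_measure_eq_zero ?_ fun x => ?_
      · exact (isOpen_ne_fun Complex.continuous_re continuous_const).measurableSet.union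
          (measurableSet_singleton 1)
      · refine measure_union_null ?_ ?_
        · exact E.measure_eq_zero_of_proj_eq_zero
            (isOpen_ne_fun Complex.continuous_re continuous_const).measurableSet
            (proj_compl_line_of_isResolutionOf hE) x
        · exact E.measure_eq_zero_of_proj_eq_zero (measurableSet_singleton 1)
            (proj_singleton_of_isResolutionOf hE 1) x
    refine E.proj_eq_zero_of_subset hm
      ((isOpen_ne_fun Complex.continuous_re continuous_const).measurableSet.union
          (measurableSet_singleton 1)) (fun s hs => ?_) h1
    by_contra hs'
    simp only [Set.mem_union, Set.mem_ofPred_eq, Set.mem_singleton_iff, not_or, not_not] at hs'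
    have := hcon _ (Set.mem_image_of_mem riemannZeta ⟨hs'.1, hs'.2⟩)
    rw [dist_comm] at this
    exact absurd (Metric.mem_ball.1 hs) (not_lt.2 this)
  · rintro ⟨_, ⟨s, ⟨hs, hs1⟩, rfl⟩, hd⟩ h0
    -- By continuity the preimage contains a ball centred on the line, and such balls have nonzero
    -- projection.
    have hcont : ContinuousAt riemannZeta s := (differentiableAt_riemannZeta hs1).continuousAt
    have hnhds : riemannZeta ⁻¹' Metric.ball a ε ∈ 𝓝 s :=
      hcont (Metric.isOpen_ball.mem_nhds (by rwa [Metric.mem_ball, dist_comm]))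
    obtain ⟨δ, hδ, hsub⟩ := Metric.mem_nhds_iff.1 hnhds
    exact proj_ball_ne_zero_of_isResolutionOf hE hs hδ
      (E.proj_eq_zero_of_subset Metric.isOpen_ball.measurableSet hm hsub h0)

theorem opSpectrum_spectralOperator (c : ℝ) :
    opSpectrum (spectralOperator c) = closure (riemannZeta '' ({s : ℂ | s.re = c} \ {1})) := by
  have h : ∃ E : ResolutionOfIdentity (WeightedL2 c), IsResolutionOf E (infinitesimalShift c) :=
    ⟨_, isResolutionOf_shiftResolution c⟩
  rw [spectralOperator, functionalCalculus, dif_pos h]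
  exact opSpectrum_integral_riemannZeta h.choose_spec

end Spectrum

end SpectralOp

end

open SpectralOp in
/-- The first conjunct says that the functional calculus of `∂_c`, hence `ζ(∂_c)`, is defined. The
pole `1` of `ζ` (on the line only when `c = 1`) is left out of the images. -/
theorem theorem3p6 (c : ℝ) (hc : 0 ≤ c) :
    (∃ E : ResolutionOfIdentity (WeightedL2 c), IsResolutionOf E (infinitesimalShift c)) ∧
    opSpectrum (spectralOperator c) =
      closure (riemannZeta '' (opSpectrum (infinitesimalShift c) \ {1})) ∧
    opSpectrum (spectralOperator c) =
      closure (riemannZeta '' ({s : ℂ | s.re = c} \ {1})) := by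
  refine ⟨⟨_, isResolutionOf_shiftResolution c⟩, ?_, opSpectrum_spectralOperator c⟩
  rw [opSpectrum_infinitesimalShift, opSpectrum_spectralOperator]
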